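/- Let $n\ge 1$, $k\ge 0$ and $\mathbf v=v_1\cdots v_k\in\{+,-\}^k$. Let $\mathcal G^{\mathbf v}_n\subseteq\mathcal S_n$ be the one-column geometric grid class of $\mathbf v$: stack $k$ unit squares in a column and draw in the $i$-th square from the bottom its diagonal of slope $1$ if $v_i=+$ and its diagonal of slope $-1$ if $v_i=-$; $\mathcal G^{\mathbf v}_n$ is the set of permutations obtained by placing $n$ dots with distinct $x$-coordinates and distinct $y$-coordinates on these segments, labelling them $1,\dots,n$ by increasing $y$-coordinate, and reading the labels by increasing $x$-coordinate. For $\pi\in\mathcal S_n$ let $\operatorname{Des}(\pi)=\{i\in[n-1]:\pi(i)>\pi(i+1)\}$, and for $J\subseteq[n-1]$ let $D_{n,J}^{-1}=\{\pi^{-1}:\pi\in\mathcal S_n,\ \operatorname{Des}(\pi)=J\}$. For $\mathbf u\in\{+,-\}^{n-1}$ let $J_{\mathbf u}=\{i:u_i=+\}$, and write $\mathbf v\le\mathbf u$ if $\mathbf v$ is a (not necessarily contiguous) subsequence of $\mathbf u$. Then $$\mathcal G^{\mathbf v}_n=\mathcal S_n\setminus\bigsqcup_{\mathbf u\in\{+,-\}^{n-1},\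 \mathbf v\le\mathbf u}D_{n,J_{\mathbf u}}^{-1}=\bigsqcup_{\mathbf u\in\{+,-\}^{n-1},\ \mathbf v\not\le\mathbf u}D_{n,J_{\mathbf u}}^{-1},$$ where the unions are disjoint. Consequently $\mathcal G^{\mathbf v}_n$ is a fine set, i.e. the quasisymmetric function $$\mathcal Q(\mathcal G^{\mathbf v}_n)=\sum_{\pi\in\mathcal G^{\mathbf v}_n}F_{n,\operatorname{Des}(\pi)},\qquad F_{n,D}=\sum_{\substack{i_1\le\cdots\le i_n\\ i_j<i_{j+1}\text{ if }j\in D}}x_{i_1}\cdots x_{i_n},$$ is symmetric and is a linear combination of Schur functions with nonnegative coefficients; moreover $$\mathcal Q(\mathcal G^{\mathbf v}_n)=\sum_{\mathbf u\in\{+,-\}^{n-1},\ \mathbf v\not\le\mathbf u}s_{Z_{n,J_{\mathbf u}}},$$ where $Z_{n,J}$ is the ribbon (skew shape, with rows numbered from top to bottom) with $n$ cells labelled $1,\dots,n$ in which cell $i+1$ is immediately above cell $i$ if $i\in J$ and immediately to the right of cell $i$ otherwise, and $s_{Z_{n,J}}$ is its skew Schur function. -/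

import Mathlib

namespace GridClasses

/-! ### Words and permutations -/

/-- The alphabet `{+, -}`. -/
inductive Sgn where
  | plus : Sgn
  | minus : Sgn
  deriving DecidableEq

instance : Fintype Sgn := ⟨{Sgn.plus, Sgn.minus}, fun x => by cases x <;> simp⟩

/-- `+` and `-` as the matrix entries `1` and `-1`. -/
def Sgn.toSignType : Sgn → SignType
  | .plus => 1
  | .minus => -1

/-- `v ≤ u`: the word `v` is a (not necessarily contiguous) subsequence of the word `u`. -/
def IsSubword {k m : ℕ} (v : Fin k → Sgn) (u : Fin m → Sgn) : Prop :=
  ∃ f : Fin k → Fin m, StrictMono f ∧ ∀ i, u (f i) = v i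

noncomputable instance {k m : ℕ} (v : Fin k → Sgn) (u : Fin m → Sgn) :
    Decidable (IsSubword v u) := Classical.propDecidable _

/-- The position `i ∈ [n-1]`, seen as a position in `[n]`. Positions are counted from `0`,
so that `i : Fin (n - 1)` stands for the element `i + 1` of `[n-1] = {1, …, n-1}`. -/
def pos {n : ℕ} (i : Fin (n - 1)) : Fin n := ⟨i, by have := i.2; omega⟩

/-- The position following `pos i`. -/
def posSucc {n : ℕ} (i : Fin (n - 1)) : Fin n := ⟨i + 1, by have := i.2; omega⟩

/-- The set `J_u = {i : u_i = +} ⊆ [n-1]` of a word `u ∈ {+, -}^{n-1}`. -/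
def wordSet {m : ℕ} (u : Fin m → Sgn) : Finset (Fin m) :=
  Finset.univ.filter fun i => u i = Sgn.plus

/-- The descent set `Des π = {i ∈ [n-1] : π(i) > π(i+1)}` of a permutation. -/
def Des {n : ℕ} (π : Equiv.Perm (Fin n)) : Finset (Fin (n - 1)) :=
  Finset.univ.filter fun i => π (posSucc i) < π (pos i)

/-- The descent class `D_{n,J}`. -/
def descentClass {n : ℕ} (J : Finset (Fin (n - 1))) : Set (Equiv.Perm (Fin n)) :=
  {π | Des π = J}

/-- The inverse descent class `D_{n,J}⁻¹ = {π⁻¹ : π ∈ D_{n,J}}`. -/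
def invDescentClass {n : ℕ} (J : Finset (Fin (n - 1))) : Set (Equiv.Perm (Fin n)) :=
  (fun π => π⁻¹) '' descentClass J

/-! ### Geometric grid classes -/

/-- The segment drawn in the unit square with lower left corner `(x, y)`:
the diagonal of slope `1` or `-1` according to the matrix entry, nothing for the entry `0`. -/
def cellSegment (e : SignType) (x y : ℝ) : Set (ℝ × ℝ) :=
  match e with
  | .zero => ∅
  | .pos => segment ℝ (x, y) (x + 1, y + 1)
  | .neg => segment ℝ (x, y + 1) (x + 1, y)

/-- The grid of a matrix: the union of its segments. The rows of the matrix are listed from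
top to bottom, so row `r` (counted from `0`) of `k` rows has height `k - 1 - r`. -/
def gridFigure {k l : ℕ} (M : Matrix (Fin k) (Fin l) SignType) : Set (ℝ × ℝ) :=
  ⋃ (r : Fin k) (c : Fin l), cellSegment (M r c) ((c : ℕ) : ℝ) ((r.rev : ℕ) : ℝ)

/-- The grid class `G_n(M)`: the permutations `π` for which there are `n` dots
`p 0, p 1, …`, listed by increasing `x`-coordinate, on the segments of the grid, such that
labelling the dots by increasing `y`-coordinate gives the dot `p i` the label `π i`
(equivalently, the `y`-coordinate increases when the dots are listed by increasing label).
In particular the `x`-coordinates are distinct and so are the `y`-coordinates. -/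
def gridClass {k l : ℕ} (M : Matrix (Fin k) (Fin l) SignType) (n : ℕ) :
    Set (Equiv.Perm (Fin n)) :=
  {π | ∃ p : Fin n → ℝ × ℝ, (∀ i, p i ∈ gridFigure M) ∧
    StrictMono (fun i => (p i).1) ∧ StrictMono (fun a => (p (π.symm a)).2)}

/-- The matrix with one column whose entries, from bottom to top, are given by `v`. -/
def columnMatrix {k : ℕ} (v : Fin k → Sgn) : Matrix (Fin k) (Fin 1) SignType :=
  fun r _ => (v r.rev).toSignType

/-- The one-column grid class `G^v_n`. -/
def columnClass {k : ℕ} (v : Fin k → Sgn) (n : ℕ) : Set (Equiv.Perm (Fin n)) :=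
  gridClass (columnMatrix v) n

/-! ### Quasisymmetric and symmetric functions

Power series with integer coefficients in countably many variables, indexed by `ℕ`. -/

/-- The formal sum `∑ i, x ^ (a i)` of a family of monomials with finite fibres: the coefficient
of `x ^ d` is the number of `i` with `a i = d`. All families below have finite fibres, because
they list functions from a fixed finite set to the variables occurring in the monomial. -/
noncomputable def monomialSum {ι : Type*} (a : ι → ℕ →₀ ℕ) : MvPowerSeries ℕ ℤ :=
  fun d => (Nat.card {i : ι // a i = d} : ℤ)

/-- The index sequences `i_1 ≤ i_2 ≤ ⋯ ≤ i_n` with `i_j < i_{j+1}` for `j ∈ D`. -/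
def FundSeq (n : ℕ) (D : Finset (Fin (n - 1))) : Type :=
  {s : Fin n → ℕ // Monotone s ∧ ∀ j ∈ D, s (pos j) < s (posSucc j)}

/-- The fundamental quasisymmetric function `F_{n,D}`. -/
noncomputable def fundamental (n : ℕ) (D : Finset (Fin (n - 1))) : MvPowerSeries ℕ ℤ :=
  monomialSum fun s : FundSeq n D => ∑ j : Fin n, Finsupp.single (s.1 j) 1

open Classical in
/-- The quasisymmetric function `Q(A) = ∑_{π ∈ A} F_{n, Des π}`. -/
noncomputable def Q {n : ℕ} (A : Set (Equiv.Perm (Fin n))) : MvPowerSeries ℕ ℤ :=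
  ∑ π : Equiv.Perm (Fin n) with π ∈ A, fundamental n (Des π)

/-- The Schur function `s_λ`, the generating function of the semistandard Young tableaux of
shape `λ` (English notation, cells are pairs `(row, column)`). -/
noncomputable def schur (lam : YoungDiagram) : MvPowerSeries ℕ ℤ :=
  monomialSum fun T : SemistandardYoungTableau lam =>
    ∑ c ∈ lam.cells, Finsupp.single (T c.1 c.2) 1

/-- Semistandard tableaux on a skew shape given by its finite set `S` of cells
`(row, column)`, rows being numbered from top to bottom: rows increase weakly, columns
increase strictly. As for Young diagrams, the entry is `0` by convention outside of `S`. -/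
structure SkewTableau (S : Finset (ℕ × ℕ)) where
  entry : ℕ → ℕ → ℕ
  row_weak : ∀ {i j₁ j₂ : ℕ}, j₁ < j₂ → (i, j₁) ∈ S → (i, j₂) ∈ S → entry i j₁ ≤ entry i j₂
  col_strict : ∀ {i₁ i₂ j : ℕ}, i₁ < i₂ → (i₁, j) ∈ S → (i₂, j) ∈ S → entry i₁ j < entry i₂ j
  zeros : ∀ {i j : ℕ}, (i, j) ∉ S → entry i j = 0

/-- The skew Schur function of a skew shape, given by its finite set of cells. -/
noncomputable def skewSchur (S : Finset (ℕ × ℕ)) : MvPowerSeries ℕ ℤ :=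
  monomialSum fun T : SkewTableau S => ∑ c ∈ S, Finsupp.single (T.entry c.1 c.2) 1

/-- A power series is symmetric if it is invariant under all permutations of the variables. -/
def IsSymmetricSeries (f : MvPowerSeries ℕ ℤ) : Prop :=
  ∀ (σ : Equiv.Perm ℕ) (d : ℕ →₀ ℕ),
    MvPowerSeries.coeff (d.mapDomain σ) f = MvPowerSeries.coeff d f

/-- `f` is a (finite) linear combination of Schur functions with nonnegative coefficients. -/
def IsSchurPositive (f : MvPowerSeries ℕ ℤ) : Prop :=
  ∃ c : YoungDiagram →₀ ℤ, (∀ lam, 0 ≤ c lam) ∧ f = c.sum fun lam a => a • schur lam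

/-- A set `A` of permutations is fine if `Q(A)` is symmetric and Schur-positive. -/
def IsFine {n : ℕ} (A : Set (Equiv.Perm (Fin n))) : Prop :=
  IsSymmetricSeries (Q A) ∧ IsSchurPositive (Q A)

/-! ### Ribbons -/

/-- Cell `j` of the ribbon `Z_{n,J}`, as `(row, column)`: one moves up at each `i ∈ J` and to
the right at each `i ∉ J`; the first cell is in column `0`, the last one in row `0`. -/
def ribbonCell {n : ℕ} (J : Finset (Fin (n - 1))) (j : Fin n) : ℕ × ℕ :=
  ((J.filter fun i : Fin (n - 1) => (j : ℕ) ≤ (i : ℕ)).card,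
    (Jᶜ.filter fun i : Fin (n - 1) => (i : ℕ) < (j : ℕ)).card)

/-- The ribbon `Z_{n,J}`, as a finite set of cells. -/
def ribbon (n : ℕ) (J : Finset (Fin (n - 1))) : Finset (ℕ × ℕ) :=
  Finset.univ.image (ribbonCell J)

/-- If `i ∈ J`, the next cell is immediately above. -/
theorem ribbonCell_of_mem {n : ℕ} (J : Finset (Fin (n - 1))) (i : Fin (n - 1)) (h : i ∈ J) :
    (ribbonCell J (posSucc i)).1 + 1 = (ribbonCell J (pos i)).1 ∧
      (ribbonCell J (posSucc i)).2 = (ribbonCell J (pos i)).2 := by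
  constructor
  · have : (J.filter fun x : Fin (n - 1) => (pos i : ℕ) ≤ (x : ℕ)) =
        insert i (J.filter fun x : Fin (n - 1) => (posSucc i : ℕ) ≤ (x : ℕ)) := by
      ext x
      simp only [Finset.mem_filter, Finset.mem_insert, Fin.ext_iff]
      simp only [pos, posSucc]
      constructor
      · rintro ⟨h1, h2⟩
        by_cases h3 : (x : ℕ) = i
        · exact Or.inl h3
        · exact Or.inr ⟨h1, by omega⟩
      · rintro (h1 | ⟨h1, h2⟩)
        · have : x = i := Fin.ext h1
          exact ⟨this ▸ h, by omega⟩
        · exact ⟨h1, by omega⟩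
    simp only [ribbonCell]
    rw [this, Finset.card_insert_of_notMem (by simp [posSucc])]
  · simp only [ribbonCell]
    congr 1
    ext x
    simp only [Finset.mem_filter, Finset.mem_compl]
    simp only [pos, posSucc]
    refine and_congr_right fun hx => ?_
    have : (x : ℕ) ≠ i := fun e => hx (by rwa [Fin.ext e])
    omega

/-- If `i ∉ J`, the next cell is immediately to the right. -/
theorem ribbonCell_of_notMem {n : ℕ} (J : Finset (Fin (n - 1))) (i : Fin (n - 1)) (h : i ∉ J) :
    (ribbonCell J (posSucc i)).1 = (ribbonCell J (pos i)).1 ∧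
      (ribbonCell J (posSucc i)).2 = (ribbonCell J (pos i)).2 + 1 := by
  constructor
  · simp only [ribbonCell]
    congr 1
    ext x
    simp only [Finset.mem_filter]
    simp only [pos, posSucc]
    refine and_congr_right fun hx => ?_
    have : (x : ℕ) ≠ i := fun e => h (by rwa [← Fin.ext e])
    omega
  · have : (Jᶜ.filter fun x : Fin (n - 1) => (x : ℕ) < (posSucc i : ℕ)) =
        insert i (Jᶜ.filter fun x : Fin (n - 1) => (x : ℕ) < (pos i : ℕ)) := by
      ext x
      simp only [Finset.mem_filter, Finset.mem_insert, Finset.mem_compl, Fin.ext_iff]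
      simp only [pos, posSucc]
      constructor
      · rintro ⟨h1, h2⟩
        by_cases h3 : (x : ℕ) = i
        · exact Or.inl h3
        · exact Or.inr ⟨h1, by omega⟩
      · rintro (h1 | ⟨h1, h2⟩)
        · have : x = i := Fin.ext h1
          exact ⟨this ▸ h, by omega⟩
        · exact ⟨h1, by omega⟩
    simp only [ribbonCell]
    rw [this, Finset.card_insert_of_notMem (by simp [pos])]

/-- The ribbon is a skew shape `lam / mu`. -/
theorem ribbon_isSkewShape (n : ℕ) (J : Finset (Fin (n - 1))) :
    ∃ lam mu : YoungDiagram, mu ≤ lam ∧ ribbon n J = lam.cells \ mu.cells := by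
  have anti : ∀ i j : Fin n, i ≤ j → (ribbonCell J j).1 ≤ (ribbonCell J i).1 := by
    intro i j h
    refine Finset.card_le_card fun x hx => ?_
    simp only [Finset.mem_filter] at hx ⊢
    exact ⟨hx.1, le_trans (Fin.le_def.mp h) hx.2⟩
  have mono : ∀ i j : Fin n, i ≤ j → (ribbonCell J i).2 ≤ (ribbonCell J j).2 := by
    intro i j h
    refine Finset.card_le_card fun x hx => ?_
    simp only [Finset.mem_filter] at hx ⊢
    exact ⟨hx.1, lt_of_lt_of_le hx.2 (Fin.le_def.mp h)⟩
  -- every lattice point between two cells is a cell: walk from one cell to the other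
  have walk : ∀ (m : ℕ) (i j : Fin n), (j : ℕ) = i + m → ∀ x : ℕ × ℕ,
      (ribbonCell J j).1 ≤ x.1 → x.1 ≤ (ribbonCell J i).1 →
      (ribbonCell J i).2 ≤ x.2 → x.2 ≤ (ribbonCell J j).2 →
      (x.1 = (ribbonCell J i).1 ∧ (ribbonCell J i).1 = (ribbonCell J j).1 ∨
        x.2 = (ribbonCell J i).2 ∧ (ribbonCell J i).2 = (ribbonCell J j).2) →
      ∃ t, ribbonCell J t = x := by
    intro m
    induction m with
    | zero =>
      intro i j hij x h1 h2 h3 h4 _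
      have : j = i := Fin.ext hij
      subst this
      exact ⟨j, Prod.ext (le_antisymm h1 h2) (le_antisymm h3 h4)⟩
    | succ m ih =>
      intro i j hij x h1 h2 h3 h4 h5
      by_cases hx : ribbonCell J i = x
      · exact ⟨i, hx⟩
      have hj := j.2
      let s : Fin (n - 1) := ⟨i, by omega⟩
      have hp : pos s = i := rfl
      have hle : posSucc s ≤ j := by
        rw [Fin.le_def]; simp only [posSucc, s]; omega
      have ha := anti _ _ hle
      have hm := mono _ _ hle
      have hne : ¬ (x.1 = (ribbonCell J i).1 ∧ x.2 = (ribbonCell J i).2) :=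
        fun h => hx (Prod.ext h.1.symm h.2.symm)
      refine ih (posSucc s) j (by simp only [posSucc, s]; omega) x h1 ?_ ?_ h4 ?_
      all_goals
        by_cases hs : s ∈ J
        · have hc := ribbonCell_of_mem J s hs
          rw [hp] at hc
          omega
        · have hc := ribbonCell_of_notMem J s hs
          rw [hp] at hc
          omega
  have conv : ∀ (a b : Fin n) (x : ℕ × ℕ), ribbonCell J a ≤ x → x ≤ ribbonCell J b →
      ∃ t, ribbonCell J t = x := by
    intro a b x h1 h2
    have h11 := (Prod.le_def.mp h1).1
    have h12 := (Prod.le_def.mp h1).2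
    have h21 := (Prod.le_def.mp h2).1
    have h22 := (Prod.le_def.mp h2).2
    rcases le_total a b with h | h
    · have := anti _ _ h
      have := mono _ _ h
      refine walk (b - a) a b ?_ x ?_ ?_ ?_ ?_ ?_
      · have := Fin.le_def.mp h; omega
      all_goals omega
    · have := anti _ _ h
      have := mono _ _ h
      refine walk (a - b) b a ?_ x ?_ ?_ ?_ ?_ ?_
      · have := Fin.le_def.mp h; omega
      all_goals omega
  let lam : YoungDiagram :=
    { cells := (ribbon n J).biUnion fun c => Finset.Iic c
      isLowerSet := by
        intro a b hab ha
        simp only [Finset.coe_biUnion, Finset.mem_coe, Set.mem_iUnion, Finset.coe_Iic,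
          Set.mem_Iic] at ha ⊢
        obtain ⟨c, hc, hac⟩ := ha
        exact ⟨c, hc, hab.trans hac⟩ }
  let mu : YoungDiagram :=
    { cells := lam.cells \ ribbon n J
      isLowerSet := by
        intro a b hab ha
        simp only [Finset.coe_sdiff, Set.mem_sdiff, Finset.mem_coe] at ha ⊢
        refine ⟨lam.isLowerSet hab ha.1, fun hb => ha.2 ?_⟩
        obtain ⟨c, hc, hac⟩ := Finset.mem_biUnion.mp ha.1
        simp only [ribbon, Finset.mem_image, Finset.mem_univ, true_and] at hb hc ⊢
        obtain ⟨i, rfl⟩ := hb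
        obtain ⟨j, rfl⟩ := hc
        exact conv i j a hab (Finset.mem_Iic.mp hac) }
  refine ⟨lam, mu, ?_, ?_⟩
  · exact Finset.sdiff_subset
  · have hsub : ribbon n J ⊆ lam.cells :=
      fun c hc => Finset.mem_biUnion.mpr ⟨c, hc, Finset.mem_Iic.mpr le_rfl⟩
    exact (Finset.sdiff_sdiff_eq_self hsub).symm

end GridClasses

open GridClasses

namespace GridClasses

/-! A drawing of `π` on the column assigns a square to each label, weakly increasing in the label.
Inside a square of sign `+` (resp. `-`) heights increase (resp. decrease) with the `x`-coordinate,
so consecutive labels may share a square exactly when its sign differs from the corresponding letter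
of the descent word of `π⁻¹`. Such an assignment exists iff `v` is not a subword of that word: each
letter of an embedded `v` forces a move to a higher square until the `k` squares run out;
conversely, moving up exactly when the greedy matching of `v` advances never leaves the column. So
membership depends only on `Des π⁻¹` (`mem_columnClass`), and the class is a union of inverse
descent classes.

For the quasisymmetric function, standardization turns pairs of a permutation `π` with `Des π⁻¹ = J`
and an index sequence `s` of its fundamental function into words `s ∘ π⁻¹` with descent set `J`.
Read along the ribbon, these words are its semistandard tableaux (`skewSchur_ribbon`). Fineness thus
reduces to ribbon Schur functions. RSK row insertion carries the descents of a word to those of its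
recording tableau (`rskQ_lt_succ_iff`), so a ribbon Schur function is the sum of the Schur functions
of the shapes of the standard tableaux with descent set `J` (`monomialSum_descentWord`). Schur
functions are symmetric by the Bender–Knuth involutions.

Tableaux are handled as Gelfand–Tsetlin patterns: there a bumping route adds at most one box per
level, and a Bender–Knuth involution reflects a single level, so most checks are linear arithmetic.
-/

theorem pos_lt_posSucc {n : ℕ} (i : Fin (n - 1)) : pos i < posSucc i := by
  simp [Fin.lt_def, pos, posSucc]

/-- A transitive relation holding along all steps from `a` to `b` relates `a` and `b`. -/
theorem rel_of_steps {n : ℕ} {R : Fin n → Fin n → Prop}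
    (trans : ∀ a b c, R a b → R b c → R a c) {a b : Fin n} (hab : a < b)
    (step : ∀ i : Fin (n - 1), a ≤ pos i → posSucc i ≤ b → R (pos i) (posSucc i)) : R a b := by
  obtain ⟨m, hm⟩ : ∃ m : ℕ, (b : ℕ) = a + m + 1 := ⟨b - a - 1, by
    have := Fin.lt_def.mp hab; omega⟩
  induction m generalizing b with
  | zero =>
    have hb := b.2
    have hs : posSucc ⟨a, by omega⟩ = b := Fin.ext (by simp only [posSucc]; omega)
    have := step ⟨a, by omega⟩ (by simp [pos]) hs.le
    rwa [hs] at this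
  | succ m ih =>
    have hb := b.2
    let s : Fin (n - 1) := ⟨a + m + 1, by omega⟩
    have h1 : R a (pos s) := by
      refine ih ?_ ?_ ?_
      · simp only [Fin.lt_def, pos, s]; omega
      · intro i h1 h2
        refine step i h1 (h2.trans ?_)
        simp only [Fin.le_def, pos, s]; omega
      · simp [pos, s]
    have hs : posSucc s = b := Fin.ext (by simp only [posSucc, s]; omega)
    have h2 := step s (by simp only [Fin.le_def, pos, s]; omega) hs.le
    rw [hs] at h2
    exact trans _ _ _ h1 h2

/-! ### Descent words -/

/-- The word of `{+, -}^{n-1}` recording the descents of a permutation by `+`. -/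
def desWord {n : ℕ} (σ : Equiv.Perm (Fin n)) : Fin (n - 1) → Sgn :=
  fun i => if σ (posSucc i) < σ (pos i) then Sgn.plus else Sgn.minus

theorem wordSet_desWord {n : ℕ} (σ : Equiv.Perm (Fin n)) : wordSet (desWord σ) = Des σ := by
  ext i
  by_cases h : σ (posSucc i) < σ (pos i) <;> simp [wordSet, desWord, Des, h]

theorem wordSet_injective {m : ℕ} : Function.Injective (wordSet (m := m)) := by
  intro u u' h
  funext i
  have hi : i ∈ wordSet u ↔ i ∈ wordSet u' := by rw [h]
  simp only [wordSet, Finset.mem_filter, Finset.mem_univ, true_and] at hi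
  cases h1 : u i <;> cases h2 : u' i <;> simp_all

theorem mem_invDescentClass {n : ℕ} {J : Finset (Fin (n - 1))} {π : Equiv.Perm (Fin n)} :
    π ∈ invDescentClass J ↔ Des π⁻¹ = J := by
  simp only [invDescentClass, descentClass, Set.mem_image, Set.mem_ofPred_eq]
  constructor
  · rintro ⟨σ, h, rfl⟩
    simpa using h
  · intro h
    exact ⟨π⁻¹, h, inv_inv π⟩

theorem mem_invDescentClass_wordSet {n : ℕ} {u : Fin (n - 1) → Sgn} {π : Equiv.Perm (Fin n)} :
    π ∈ invDescentClass (wordSet u) ↔ desWord π⁻¹ = u := by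
  rw [mem_invDescentClass, ← wordSet_desWord, wordSet_injective.eq_iff]

/-! ### Row assignments -/

/-- A distribution of the labels over the squares of the column such that consecutive labels in
the same square have the relative position prescribed by the diagonal of this square; `u` is the
word marking by `+` the labels lying to the right of the next one. -/
def IsRowAssignment {n k : ℕ} (v : Fin k → Sgn) (u : Fin (n - 1) → Sgn) (r : Fin n → Fin k) :
    Prop :=
  Monotone r ∧ ∀ i, r (pos i) = r (posSucc i) → v (r (pos i)) ≠ u i

/-- At the position matched with `v j`, the two adjacent labels cannot both lie in square `j`. By
induction the later of them lies strictly above square `j`, and the last letter of `v` leaves no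
square. -/
theorem IsRowAssignment.not_isSubword {n k : ℕ} (hn : 1 ≤ n) {v : Fin k → Sgn}
    {u : Fin (n - 1) → Sgn} {r : Fin n → Fin k} (h : IsRowAssignment v u r) :
    ¬ IsSubword v u := by
  rintro ⟨f, hf, hfu⟩
  have key : ∀ j : ℕ, ∀ hj : j < k, j < (r (posSucc (f ⟨j, hj⟩)) : ℕ) := by
    intro j
    induction j with
    | zero =>
      intro hj
      by_contra hlt
      have h1 := h.1 (pos_lt_posSucc (f ⟨0, hj⟩)).le
      have h0 : r (posSucc (f ⟨0, hj⟩)) = ⟨0, hj⟩ := Fin.ext (by simp; omega)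
      have h2 : r (pos (f ⟨0, hj⟩)) = ⟨0, hj⟩ := by
        apply Fin.ext; rw [h0, Fin.le_def] at h1; simp at h1; simp; omega
      exact h.2 _ (h2.trans h0.symm) (by rw [h2, hfu])
    | succ j ih =>
      intro hj
      have h1 := ih (by omega)
      have hff : f ⟨j, by omega⟩ < f ⟨j + 1, hj⟩ := hf (by simp [Fin.lt_def])
      have h2 : r (posSucc (f ⟨j, by omega⟩)) ≤ r (pos (f ⟨j + 1, hj⟩)) := by
        apply h.1
        rw [Fin.lt_def] at hff
        simp only [Fin.le_def, pos, posSucc]; omega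
      have h3 := h.1 (pos_lt_posSucc (f ⟨j + 1, hj⟩)).le
      rw [Fin.le_def] at h2 h3
      by_contra hlt
      have h4 : r (posSucc (f ⟨j + 1, hj⟩)) = ⟨j + 1, hj⟩ := Fin.ext (by simp; omega)
      have h5 : r (pos (f ⟨j + 1, hj⟩)) = ⟨j + 1, hj⟩ := by
        apply Fin.ext; rw [h4] at h3; simp at h3; simp; omega
      exact h.2 _ (h5.trans h4.symm) (by rw [h5, hfu])
  -- A label exists because `1 ≤ n`, and it needs a square; this excludes `k = 0`.
  have hk : 0 < k := (r ⟨0, hn⟩).pos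
  have := key (k - 1) (by omega)
  have := (r (posSucc (f ⟨k - 1, by omega⟩))).2
  omega

/-- The number of letters of `v` matched greedily in the first `i` letters of `u`. -/
def greedyRow {k m : ℕ} (v : Fin k → Sgn) (u : Fin m → Sgn) : ℕ → ℕ
  | 0 => 0
  | i + 1 =>
    if ∃ (h₁ : greedyRow v u i < k) (h₂ : i < m), v ⟨greedyRow v u i, h₁⟩ = u ⟨i, h₂⟩ then
      greedyRow v u i + 1
    else greedyRow v u i

theorem greedyRow_le_succ {k m : ℕ} (v : Fin k → Sgn) (u : Fin m → Sgn) (i : ℕ) :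
    greedyRow v u i ≤ greedyRow v u (i + 1) := by
  rw [greedyRow]; split_ifs <;> omega

/-- The positions where the greedy matching advances embed a prefix of `v`. The bound `f j < i`
keeps the embedding strictly increasing when position `i` is appended. -/
theorem greedyRow_embedding {k m : ℕ} (v : Fin k → Sgn) (u : Fin m → Sgn) (i : ℕ) :
    ∃ f : Fin (greedyRow v u i) → Fin m, StrictMono f ∧
      ∀ j, (f j : ℕ) < i ∧ ∃ h : (j : ℕ) < k, u (f j) = v ⟨j, h⟩ := by
  induction i with
  | zero => exact ⟨fun j => absurd j.2 (by simp [greedyRow]), fun j => absurd j.2 (by simp [greedyRow]),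
      fun j => absurd j.2 (by simp [greedyRow])⟩
  | succ i ih =>
    obtain ⟨f, hf, hfu⟩ := ih
    by_cases h : ∃ (h₁ : greedyRow v u i < k) (h₂ : i < m), v ⟨greedyRow v u i, h₁⟩ = u ⟨i, h₂⟩
    · have e : greedyRow v u (i + 1) = greedyRow v u i + 1 := by rw [greedyRow, if_pos h]
      rw [e]
      obtain ⟨h1, h2, h3⟩ := h
      refine ⟨Fin.snoc (α := fun _ => Fin m) f ⟨i, h2⟩, ?_, ?_⟩
      · intro a b hab
        induction b using Fin.lastCases with
        | last =>
          induction a using Fin.lastCases with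
          | last => exact absurd hab (lt_irrefl _)
          | cast a => simpa [Fin.lt_def] using (hfu a).1
        | cast b =>
          induction a using Fin.lastCases with
          | last => exact absurd (hab.trans (Fin.castSucc_lt_last b)) (lt_irrefl _)
          | cast a => simpa using hf (Fin.castSucc_lt_castSucc_iff.mp hab)
      · intro j
        induction j using Fin.lastCases with
        | last => exact ⟨by simp, h1, by simpa using h3.symm⟩
        | cast j =>
          obtain ⟨h4, h5, h6⟩ := hfu j
          exact ⟨by simp; omega, h5, by simpa using h6⟩
    · have e : greedyRow v u (i + 1) = greedyRow v u i := by rw [greedyRow, if_neg h]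
      rw [e]
      exact ⟨f, hf, fun j => ⟨by have := (hfu j).1; omega, (hfu j).2⟩⟩

/-- Label `i` goes to the square of the first letter of `v` still unmatched after `i` letters of
`u`. If the greedy count reached `k`, all of `v` would be embedded. -/
theorem exists_isRowAssignment {n k : ℕ} {v : Fin k → Sgn} {u : Fin (n - 1) → Sgn}
    (h : ¬ IsSubword v u) : ∃ r : Fin n → Fin k, IsRowAssignment v u r := by
  have hlt : ∀ i, greedyRow v u i < k := by
    intro i
    by_contra hk
    obtain ⟨f, hf, hfu⟩ := greedyRow_embedding v u i
    refine h ⟨fun j => f ⟨j, by omega⟩, fun a b hab => hf hab, fun j => ?_⟩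
    obtain ⟨_, _, h2⟩ := hfu ⟨j, by omega⟩
    simpa using h2
  refine ⟨fun i => ⟨greedyRow v u i, hlt i⟩, fun a b hab => ?_, fun i hi hv => ?_⟩
  · exact monotone_nat_of_le_succ (greedyRow_le_succ v u) (Fin.le_def.mp hab)
  · simp only [pos, posSucc, Fin.mk.injEq] at hi hv
    rw [greedyRow, if_pos ⟨hlt _, i.2, by simpa using hv⟩] at hi
    omega

theorem exists_isRowAssignment_iff {n k : ℕ} (hn : 1 ≤ n) {v : Fin k → Sgn}
    {u : Fin (n - 1) → Sgn} :
    (∃ r : Fin n → Fin k, IsRowAssignment v u r) ↔ ¬ IsSubword v u :=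
  ⟨fun ⟨_, hr⟩ => hr.not_isSubword hn, exists_isRowAssignment⟩

/-! ### The one-column grid class -/

theorem mem_cellSegment_toSignType {e : Sgn} {y : ℝ} {p : ℝ × ℝ} :
    p ∈ cellSegment e.toSignType 0 y ↔
      0 ≤ p.1 ∧ p.1 ≤ 1 ∧ p.2 = y + (if e = Sgn.plus then p.1 else 1 - p.1) := by
  obtain ⟨a, b⟩ := p
  cases e
  · change (a, b) ∈ segment ℝ ((0 : ℝ), y) (0 + 1, y + 1) ↔ _
    rw [segment_eq_image]
    simp only [Set.mem_image, Set.mem_Icc, Prod.smul_mk, Prod.mk_add_mk, Prod.mk.injEq, smul_eq_mul]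
    constructor
    · rintro ⟨t, ⟨h1, h2⟩, h3, h4⟩
      refine ⟨by linarith, by linarith, ?_⟩
      simp only [if_true]; linarith
    · rintro ⟨h1, h2, h3⟩
      simp only [if_true] at h3
      exact ⟨a, ⟨h1, h2⟩, by ring, by rw [h3]; ring⟩
  · change (a, b) ∈ segment ℝ ((0 : ℝ), y + 1) (0 + 1, y) ↔ _
    rw [segment_eq_image]
    simp only [Set.mem_image, Set.mem_Icc, Prod.smul_mk, Prod.mk_add_mk, Prod.mk.injEq, smul_eq_mul]
    constructor
    · rintro ⟨t, ⟨h1, h2⟩, h3, h4⟩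
      refine ⟨by linarith, by linarith, ?_⟩
      simp only [reduceCtorEq, if_false]; linarith
    · rintro ⟨h1, h2, h3⟩
      simp only [reduceCtorEq, if_false] at h3
      exact ⟨a, ⟨h1, h2⟩, by ring, by rw [h3]; ring⟩

/-- The reversals in `columnMatrix` and `gridFigure` cancel, so the letter `v r` sits at height `r`.
-/
theorem mem_gridFigure_columnMatrix {k : ℕ} {v : Fin k → Sgn} {p : ℝ × ℝ} :
    p ∈ gridFigure (columnMatrix v) ↔ ∃ r : Fin k,
      0 ≤ p.1 ∧ p.1 ≤ 1 ∧ p.2 = (r : ℕ) + (if v r = Sgn.plus then p.1 else 1 - p.1) := by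
  simp only [gridFigure, Set.mem_iUnion, columnMatrix]
  constructor
  · rintro ⟨r, c, h⟩
    have hc : (c : ℕ) = 0 := by omega
    rw [hc, Nat.cast_zero, mem_cellSegment_toSignType] at h
    exact ⟨r.rev, h⟩
  · rintro ⟨r, h⟩
    refine ⟨r.rev, 0, ?_⟩
    simp only [Fin.rev_rev, Fin.val_zero, Nat.cast_zero]
    exact mem_cellSegment_toSignType.mpr h

theorem mem_columnClass_iff_rowAssignment {n k : ℕ} {v : Fin k → Sgn} {π : Equiv.Perm (Fin n)} :
    π ∈ columnClass v n ↔ ∃ r : Fin n → Fin k, IsRowAssignment v (desWord π⁻¹) r := by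
  constructor
  · rintro ⟨p, hp, hx, hy⟩
    choose row hrow using fun i => mem_gridFigure_columnMatrix.mp (hp i)
    refine ⟨fun a => row (π.symm a), fun a b hab => ?_, fun i hi => ?_⟩
    · rcases hab.eq_or_lt with rfl | hab
      · exact le_rfl
      have h1 := hy hab
      obtain ⟨ha0, ha1, ha⟩ := hrow (π.symm a)
      obtain ⟨hb0, hb1, hb⟩ := hrow (π.symm b)
      simp only at h1
      -- The dots lie in closed unit squares, so a dot on a common boundary may be given either row;
      -- strictness of the heights still yields a weak inequality of rows.
      have h2 : ((row (π.symm a) : ℕ) : ℝ) < (row (π.symm b) : ℕ) + 1 := by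
        split_ifs at ha hb <;> linarith
      rw [Fin.le_def]
      exact Nat.lt_succ_iff.mp (by exact_mod_cast h2)
    · have h1 := hy (pos_lt_posSucc i)
      obtain ⟨_, _, ha⟩ := hrow (π.symm (pos i))
      obtain ⟨_, _, hb⟩ := hrow (π.symm (posSucc i))
      simp only at h1 hi
      rw [← hi] at hb
      have hxx := hx.lt_iff_lt (a := π.symm (posSucc i)) (b := π.symm (pos i))
      simp only [desWord, Equiv.Perm.inv_def]
      cases hv : v (row (π.symm (pos i)))
      · simp only [hv, if_true] at ha hb
        rw [if_neg (by rw [← hxx]; linarith)]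
        simp
      · simp only [hv, reduceCtorEq, if_false] at ha hb
        rw [if_pos (by rw [← hxx]; linarith)]
        simp
  · rintro ⟨r, hr, hv⟩
    -- The coordinates lie strictly between `0` and `1`, so no dot touches the boundary between two
    -- squares.
    let x : Fin n → ℝ := fun i => ((i : ℕ) + 1 : ℝ) / (n + 1)
    have hx : StrictMono x := by
      intro i j hij
      have : ((i : ℕ) : ℝ) < (j : ℕ) := by exact_mod_cast hij
      show ((i : ℕ) + 1 : ℝ) / (n + 1) < ((j : ℕ) + 1 : ℝ) / (n + 1)
      gcongr
    have hx0 : ∀ i, 0 < x i := fun i => by positivity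
    have hx1 : ∀ i, x i < 1 := fun i => by
      show ((i : ℕ) + 1 : ℝ) / (n + 1) < 1
      rw [div_lt_one (by positivity)]
      have : ((i : ℕ) : ℝ) < n := by exact_mod_cast i.2
      linarith
    refine ⟨fun i => (x i, (r (π i) : ℕ) + (if v (r (π i)) = Sgn.plus then x i else 1 - x i)),
      fun i => mem_gridFigure_columnMatrix.mpr ⟨r (π i), (hx0 i).le, (hx1 i).le, rfl⟩, hx, ?_⟩
    intro a b hab
    refine rel_of_steps (R := fun a b : Fin n =>
      (r (π (π.symm a)) : ℕ) +
          (if v (r (π (π.symm a))) = Sgn.plus then x (π.symm a) else 1 - x (π.symm a)) <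
        (r (π (π.symm b)) : ℕ) +
          (if v (r (π (π.symm b))) = Sgn.plus then x (π.symm b) else 1 - x (π.symm b)))
      (fun _ _ _ => lt_trans) hab fun i _ _ => ?_
    simp only [Equiv.apply_symm_apply]
    have h0 := hx0 (π.symm (pos i))
    have h1 := hx1 (π.symm (pos i))
    have h2 := hx0 (π.symm (posSucc i))
    have h3 := hx1 (π.symm (posSucc i))
    rcases (hr (pos_lt_posSucc i).le).eq_or_lt with h | h
    · have h4 := hv i h
      simp only [desWord, Equiv.Perm.inv_def] at h4
      rw [← h]
      cases hv : v (r (pos i))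
      · rw [hv] at h4
        have h5 : ¬ π.symm (posSucc i) < π.symm (pos i) := fun h => by simp [h] at h4
        have h6 : π.symm (pos i) < π.symm (posSucc i) :=
          lt_of_le_of_ne (not_lt.mp h5) fun e =>
            (pos_lt_posSucc i).ne (π.symm.injective e)
        have := hx h6
        simp only [if_true]; linarith
      · rw [hv] at h4
        have h5 : π.symm (posSucc i) < π.symm (pos i) := by
          by_contra h
          simp [h] at h4
        have := hx h5
        simp only [reduceCtorEq, if_false]; linarith
    · have h5 : ((r (pos i) : ℕ) : ℝ) + 1 ≤ (r (posSucc i) : ℕ) := by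
        exact_mod_cast Fin.lt_def.mp h
      split_ifs <;> linarith

theorem mem_columnClass {n k : ℕ} (hn : 1 ≤ n) {v : Fin k → Sgn} {π : Equiv.Perm (Fin n)} :
    π ∈ columnClass v n ↔ ¬ IsSubword v (desWord π⁻¹) :=
  mem_columnClass_iff_rowAssignment.trans (exists_isRowAssignment_iff hn)

/-! ### Formal sums of monomials -/

theorem monomialSum_congr {ι κ : Type*} {a : ι → ℕ →₀ ℕ} {b : κ → ℕ →₀ ℕ} (e : ι ≃ κ)
    (h : ∀ i, b (e i) = a i) : monomialSum a = monomialSum b := by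
  funext d
  simp only [monomialSum]
  exact congrArg _ (Nat.card_congr (e.subtypeEquiv fun i => by rw [h]))

/-- Finiteness of the fibres is essential: `Nat.card` is `0` on infinite types and so is not
additive in general. -/
theorem monomialSum_sigma {α : Type*} [Fintype α] {β : α → Type*} (a : (Σ x, β x) → ℕ →₀ ℕ)
    (hfin : ∀ d, Finite {i // a i = d}) :
    monomialSum a = ∑ x, monomialSum fun b : β x => a ⟨x, b⟩ := by
  ext d
  rw [map_sum]
  simp only [monomialSum, MvPowerSeries.coeff_apply]
  have hf : ∀ x, Finite {b : β x // a ⟨x, b⟩ = d} := fun x =>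
    Finite.of_injective (fun b => (⟨⟨x, b.1⟩, b.2⟩ : {i // a i = d})) fun b b' h => by
      simpa [Subtype.ext_iff] using h
  rw [← Nat.cast_sum, ← Nat.card_sigma]
  refine congrArg _ (Nat.card_congr
    ⟨fun i => ⟨i.1.1, i.1.2, i.2⟩, fun i => ⟨⟨i.1, i.2.1⟩, i.2.2⟩, fun _ => rfl, fun _ => rfl⟩)

/-! ### Words with a given descent set -/

/-- The content of a word, as an exponent vector. -/
noncomputable def content {n : ℕ} (t : Fin n → ℕ) : ℕ →₀ ℕ := ∑ j, Finsupp.single (t j) 1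

theorem content_apply {n : ℕ} (t : Fin n → ℕ) (c : ℕ) :
    content t c = (Finset.univ.filter fun j => t j = c).card := by
  simp [content, Finsupp.finsetSum_apply, Finsupp.single_apply]

theorem finite_content_eq {n : ℕ} (d : ℕ →₀ ℕ) : {t : Fin n → ℕ | content t = d}.Finite := by
  refine Set.Finite.subset (Set.Finite.pi' fun _ : Fin n => d.support.finite_toSet) ?_
  rintro t rfl j
  rw [Finset.mem_coe, Finsupp.mem_support_iff, content_apply]
  exact Finset.card_ne_zero_of_mem (a := j) (by simp)

/-- The words of length `n` with descent set `J`. -/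
def DescentWord (n : ℕ) (J : Finset (Fin (n - 1))) : Type :=
  {t : Fin n → ℕ // ∀ i, t (posSucc i) < t (pos i) ↔ i ∈ J}

theorem finite_descentWord_content {n : ℕ} (J : Finset (Fin (n - 1))) (d : ℕ →₀ ℕ) :
    Finite {t : DescentWord n J // content t.1 = d} := by
  have := (finite_content_eq (n := n) d).to_subtype
  refine Finite.of_injective
    (fun t => (⟨t.1.1, t.2⟩ : {t : Fin n → ℕ | content t = d})) fun t t' h => ?_
  exact Subtype.ext (Subtype.ext (by simpa using h))

/-! ### Standardization -/

/-- A monotone `s` with equal ends is constant in between, and `s` must increase at each descent of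
`π`; so `π` has no descent there. -/
theorem FundSeq.stable {n : ℕ} {π : Equiv.Perm (Fin n)} (s : FundSeq n (Des π)) {a b : Fin n}
    (hab : a < b) (h : s.1 a = s.1 b) : π a < π b := by
  refine rel_of_steps (R := fun a b => π a < π b) (fun _ _ _ => lt_trans) hab fun i h1 h2 => ?_
  have hs : s.1 (pos i) = s.1 (posSucc i) := by
    refine le_antisymm (s.2.1 (pos_lt_posSucc i).le) ?_
    exact (s.2.1 h2).trans (h.symm.le.trans (s.2.1 h1))
  by_contra hlt
  have hne : π (posSucc i) ≠ π (pos i) := fun e => (pos_lt_posSucc i).ne' (π.injective e)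
  exact (s.2.2 i (by simpa [Des] using lt_of_le_of_ne (not_lt.mp hlt) hne)).ne hs

/-- Since `s` is the increasing rearrangement of the word `s ∘ π⁻¹` and ties are ordered stably, `π`
is its stable sorting permutation. Hence the word determines `π`. -/
theorem FundSeq.eq_sort {n : ℕ} {π : Equiv.Perm (Fin n)} (s : FundSeq n (Des π)) :
    π = Tuple.sort (s.1 ∘ ⇑π⁻¹) := by
  have hcomp : (s.1 ∘ ⇑π⁻¹) ∘ π = s.1 := by
    funext i; simp
  rw [Tuple.eq_sort_iff, hcomp]
  exact ⟨s.2.1, fun i j hij h => s.stable hij (by simpa using h)⟩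

/-- Monotonicity of `s` gives one direction; in the other, a tie would contradict stability. -/
theorem comp_inv_lt_iff {n : ℕ} {π : Equiv.Perm (Fin n)} (s : FundSeq n (Des π))
    (i : Fin (n - 1)) :
    (s.1 ∘ ⇑π⁻¹) (posSucc i) < (s.1 ∘ ⇑π⁻¹) (pos i) ↔ i ∈ Des π⁻¹ := by
  simp only [Des, Finset.mem_filter, Finset.mem_univ, true_and, Function.comp]
  constructor
  · intro h
    by_contra hlt
    exact h.not_ge (s.2.1 (not_lt.mp hlt))
  · intro h
    refine lt_of_le_of_ne (s.2.1 h.le) fun e => ?_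
    have := s.stable h e
    simp only [Equiv.Perm.inv_def, Equiv.apply_symm_apply] at this
    exact absurd this (pos_lt_posSucc i).not_gt

theorem sort_mem_fundSeq {n : ℕ} (t : Fin n → ℕ) :
    Monotone (t ∘ Tuple.sort t) ∧ ∀ j ∈ Des (Tuple.sort t),
      (t ∘ Tuple.sort t) (pos j) < (t ∘ Tuple.sort t) (posSucc j) := by
  obtain ⟨h1, h2⟩ := Tuple.eq_sort_iff.mp (rfl : Tuple.sort t = Tuple.sort t)
  refine ⟨h1, fun j hj => lt_of_le_of_ne (h1 (pos_lt_posSucc j).le) fun e => ?_⟩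
  have := h2 _ _ (pos_lt_posSucc j) e
  simp only [Des, Finset.mem_filter, Finset.mem_univ, true_and] at hj
  exact absurd this hj.not_gt

/-- Standardization: a word corresponds to the inverse of its standardization together with its
weakly increasing rearrangement. -/
noncomputable def standardization {n : ℕ} (J : Finset (Fin (n - 1))) :
    (Σ π : {π : Equiv.Perm (Fin n) // Des π⁻¹ = J}, FundSeq n (Des π.1)) ≃ DescentWord n J :=
  Equiv.ofBijective
    (fun x => ⟨x.2.1 ∘ ⇑x.1.1⁻¹, fun i => by rw [comp_inv_lt_iff, x.1.2]⟩) <| by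
    constructor
    · rintro ⟨⟨π, hπ⟩, s⟩ ⟨⟨π', hπ'⟩, s'⟩ h
      have h1 : s.1 ∘ ⇑π⁻¹ = s'.1 ∘ ⇑π'⁻¹ := congrArg Subtype.val h
      have h2 : π = π' := s.eq_sort.trans ((congrArg Tuple.sort h1).trans s'.eq_sort.symm)
      subst h2
      have h3 : s = s' := Subtype.ext (by
        funext i
        simpa using congrFun h1 (π i))
      rw [h3]
    · rintro ⟨t, ht⟩
      let s : FundSeq n (Des (Tuple.sort t)) := ⟨t ∘ Tuple.sort t, sort_mem_fundSeq t⟩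
      have hs : s.1 ∘ ⇑(Tuple.sort t)⁻¹ = t := by
        funext i; simp [s]
      refine ⟨⟨⟨Tuple.sort t, ?_⟩, s⟩, Subtype.ext hs⟩
      ext i
      rw [← comp_inv_lt_iff s, hs, ht]

theorem content_standardization {n : ℕ} (J : Finset (Fin (n - 1)))
    (x : Σ π : {π : Equiv.Perm (Fin n) // Des π⁻¹ = J}, FundSeq n (Des π.1)) :
    content (standardization J x).1 = ∑ j : Fin n, Finsupp.single (x.2.1 j) 1 :=
  Equiv.sum_comp x.1.1⁻¹ fun j => Finsupp.single (x.2.1 j) 1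

theorem sum_fundamental_invDescentClass {n : ℕ} (J : Finset (Fin (n - 1))) :
    ∑ π : Equiv.Perm (Fin n) with Des π⁻¹ = J, fundamental n (Des π) =
      monomialSum fun t : DescentWord n J => content t.1 := by
  rw [← monomialSum_congr (standardization J)
    (a := fun x => ∑ j : Fin n, Finsupp.single (x.2.1 j) 1) (content_standardization J),
    monomialSum_sigma, ← Finset.sum_subtype_eq_sum_filter, Finset.subtype_univ]
  · rfl
  · intro d
    have := finite_descentWord_content J d
    refine Finite.of_equiv {t : DescentWord n J // content t.1 = d} ((standardization J).subtypeEquiv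
      (p := fun x => ∑ j : Fin n, Finsupp.single (x.2.1 j) 1 = d) fun x => ?_).symm
    rw [content_standardization]

/-! ### Tableaux of ribbon shape -/

/-- Each step of the ribbon, up or right, raises column minus row by one. This difference therefore
identifies the cell. -/
theorem ribbonCell_snd_add {n : ℕ} (J : Finset (Fin (n - 1))) (j : Fin n) :
    (ribbonCell J j).2 + J.card = (ribbonCell J j).1 + j := by
  have h1 := Finset.card_filter_add_card_filter_not (s := J) fun i : Fin (n - 1) => (j : ℕ) ≤ i
  have h2 : (J.filter fun i : Fin (n - 1) => ¬ (j : ℕ) ≤ i).card +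
      (Jᶜ.filter fun i : Fin (n - 1) => (i : ℕ) < j).card = j := by
    rw [← Finset.card_union_of_disjoint]
    · have : (J.filter fun i : Fin (n - 1) => ¬ (j : ℕ) ≤ i) ∪
          (Jᶜ.filter fun i : Fin (n - 1) => (i : ℕ) < j) =
          Finset.univ.filter fun i : Fin (n - 1) => (i : ℕ) < j := by
        ext i
        simp only [Finset.mem_union, Finset.mem_filter, Finset.mem_compl, Finset.mem_univ,
          true_and, not_le]
        tauto
      rw [this, Fin.card_filter_val_lt]
      have := j.2
      omega
    · rw [Finset.disjoint_left]
      intro i hi hi'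
      simp only [Finset.mem_filter, Finset.mem_compl] at hi hi'
      exact hi'.1 hi.1
  simp only [ribbonCell]
  omega

theorem ribbonCell_injective {n : ℕ} (J : Finset (Fin (n - 1))) :
    Function.Injective (ribbonCell J) := by
  intro a b h
  have ha := ribbonCell_snd_add J a
  have hb := ribbonCell_snd_add J b
  rw [h] at ha
  exact Fin.ext (by omega)

theorem ribbonCell_mem {n : ℕ} (J : Finset (Fin (n - 1))) (j : Fin n) :
    ((ribbonCell J j).1, (ribbonCell J j).2) ∈ ribbon n J :=
  Finset.mem_image_of_mem _ (Finset.mem_univ j)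

theorem ribbonCell_fst_antitone {n : ℕ} (J : Finset (Fin (n - 1))) {a b : Fin n} (h : a ≤ b) :
    (ribbonCell J b).1 ≤ (ribbonCell J a).1 :=
  Finset.card_le_card fun x hx => by
    simp only [Finset.mem_filter] at hx ⊢
    exact ⟨hx.1, (Fin.le_def.mp h).trans hx.2⟩

theorem ribbonCell_snd_monotone {n : ℕ} (J : Finset (Fin (n - 1))) {a b : Fin n} (h : a ≤ b) :
    (ribbonCell J a).2 ≤ (ribbonCell J b).2 :=
  Finset.card_le_card fun x hx => by
    simp only [Finset.mem_filter] at hx ⊢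
    exact ⟨hx.1, hx.2.trans_le (Fin.le_def.mp h)⟩

/-- Rows are monotone along the ribbon, so between two cells of one row there is no upward step,
that is, no descent. -/
theorem DescentWord.row_weak {n : ℕ} {J : Finset (Fin (n - 1))} (t : DescentWord n J)
    {a b : Fin n} (h : (ribbonCell J a).1 = (ribbonCell J b).1)
    (h' : (ribbonCell J a).2 < (ribbonCell J b).2) : t.1 a ≤ t.1 b := by
  have hab : a < b := by
    by_contra hle
    exact h'.not_ge (ribbonCell_snd_monotone J (not_lt.mp hle))
  refine rel_of_steps (R := fun a b => t.1 a ≤ t.1 b) (fun _ _ _ => le_trans) hab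
    fun i h1 h2 => ?_
  rw [← not_lt, t.2]
  intro hi
  have h3 := ribbonCell_of_mem J i hi
  have h4 := ribbonCell_fst_antitone J h1
  have h5 := ribbonCell_fst_antitone J h2
  omega

theorem DescentWord.col_strict {n : ℕ} {J : Finset (Fin (n - 1))} (t : DescentWord n J)
    {a b : Fin n} (h : (ribbonCell J a).2 = (ribbonCell J b).2)
    (h' : (ribbonCell J a).1 < (ribbonCell J b).1) : t.1 a < t.1 b := by
  have hab : b < a := by
    by_contra hle
    exact h'.not_ge (ribbonCell_fst_antitone J (not_lt.mp hle))
  -- Rows are numbered from the top, so the upper cell `a` comes later in the word; all steps from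
  -- `b` to `a` are upward, hence descents.
  refine rel_of_steps (R := fun a b => t.1 b < t.1 a) (fun _ _ _ h1 h2 => h2.trans h1) hab
    fun i h1 h2 => ?_
  rw [t.2]
  by_contra hi
  have h3 := ribbonCell_of_notMem J i hi
  have h4 := ribbonCell_snd_monotone J h1
  have h5 := ribbonCell_snd_monotone J h2
  omega

theorem SkewTableau.ext_entry {S : Finset (ℕ × ℕ)} {T T' : SkewTableau S}
    (h : ∀ c ∈ S, T.entry c.1 c.2 = T'.entry c.1 c.2) : T = T' := by
  have : T.entry = T'.entry := by
    funext i j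
    by_cases hc : (i, j) ∈ S
    · exact h _ hc
    · rw [T.zeros hc, T'.zeros hc]
  cases T; cases T'; congr

open Classical in
/-- The filling of the ribbon reading a given word. -/
noncomputable def ribbonEntry {n : ℕ} (J : Finset (Fin (n - 1))) (t : Fin n → ℕ) (i j : ℕ) : ℕ :=
  if h : ∃ a, ribbonCell J a = (i, j) then t h.choose else 0

theorem ribbonEntry_ribbonCell {n : ℕ} (J : Finset (Fin (n - 1))) (t : Fin n → ℕ) (a : Fin n) :
    ribbonEntry J t (ribbonCell J a).1 (ribbonCell J a).2 = t a := by
  have h : ∃ b, ribbonCell J b = ((ribbonCell J a).1, (ribbonCell J a).2) := ⟨a, rfl⟩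
  rw [ribbonEntry, dif_pos h]
  exact congrArg t (ribbonCell_injective J h.choose_spec)

theorem exists_ribbonCell_of_mem {n : ℕ} {J : Finset (Fin (n - 1))} {c : ℕ × ℕ}
    (h : c ∈ ribbon n J) : ∃ a, ribbonCell J a = c := by
  simpa [ribbon] using h

/-- Semistandard tableaux of ribbon shape `Z_{n,J}` are words with descent set `J`. -/
noncomputable def ribbonTableauEquiv {n : ℕ} (J : Finset (Fin (n - 1))) :
    SkewTableau (ribbon n J) ≃ DescentWord n J where
  toFun T := ⟨fun a => T.entry (ribbonCell J a).1 (ribbonCell J a).2, fun i => by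
    have h1 := ribbonCell_mem J (pos i)
    have h2 := ribbonCell_mem J (posSucc i)
    by_cases hi : i ∈ J
    · obtain ⟨h3, h4⟩ := ribbonCell_of_mem J i hi
      simp only [h4] at h2 ⊢
      exact iff_of_true (T.col_strict (by omega) h2 h1) hi
    · obtain ⟨h3, h4⟩ := ribbonCell_of_notMem J i hi
      simp only [h3] at h2 ⊢
      exact iff_of_false (T.row_weak (by omega) h1 h2).not_gt hi⟩
  invFun t :=
    { entry := ribbonEntry J t.1
      row_weak := by
        intro i j₁ j₂ hj h1 h2
        obtain ⟨a, ha⟩ := exists_ribbonCell_of_mem h1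
        obtain ⟨b, hb⟩ := exists_ribbonCell_of_mem h2
        have ea := ribbonEntry_ribbonCell J t.1 a
        have eb := ribbonEntry_ribbonCell J t.1 b
        rw [ha] at ea
        rw [hb] at eb
        simp only at ea eb
        rw [ea, eb]
        exact t.row_weak (by rw [ha, hb]) (by rw [ha, hb]; exact hj)
      col_strict := by
        intro i₁ i₂ j hi h1 h2
        obtain ⟨a, ha⟩ := exists_ribbonCell_of_mem h1
        obtain ⟨b, hb⟩ := exists_ribbonCell_of_mem h2
        have ea := ribbonEntry_ribbonCell J t.1 a
        have eb := ribbonEntry_ribbonCell J t.1 b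
        rw [ha] at ea
        rw [hb] at eb
        simp only at ea eb
        rw [ea, eb]
        exact t.col_strict (by rw [ha, hb]) (by rw [ha, hb]; exact hi)
      zeros := by
        intro i j h
        rw [ribbonEntry, dif_neg]
        rintro ⟨a, ha⟩
        exact h (ha ▸ ribbonCell_mem J a) }
  left_inv T := SkewTableau.ext_entry fun c hc => by
    obtain ⟨a, rfl⟩ := exists_ribbonCell_of_mem hc
    exact ribbonEntry_ribbonCell J _ a
  right_inv t := Subtype.ext (funext fun a => ribbonEntry_ribbonCell J t.1 a)

theorem skewSchur_ribbon {n : ℕ} (J : Finset (Fin (n - 1))) :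
    skewSchur (ribbon n J) = monomialSum fun t : DescentWord n J => content t.1 := by
  refine monomialSum_congr (ribbonTableauEquiv J) fun T => ?_
  exact (Finset.sum_image (f := fun c : ℕ × ℕ => Finsupp.single (T.entry c.1 c.2) 1)
    (ribbonCell_injective J).injOn).symm

/-! ### Gelfand–Tsetlin patterns -/

/-- An infinite Gelfand–Tsetlin pattern: `L c a` is to be thought of as the number of entries
smaller than `c` in row `a` of a semistandard tableau. -/
structure IsGT (L : ℕ → ℕ → ℕ) : Prop where
  zero : ∀ a, L 0 a = 0
  le_succ : ∀ c a, L c a ≤ L (c + 1) a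
  interlace : ∀ c a, L (c + 1) (a + 1) ≤ L c a

/-- The rows of the pattern are eventually equal to `f`. -/
def HasShape (L : ℕ → ℕ → ℕ) (f : ℕ → ℕ) : Prop := ∃ N, ∀ c, N ≤ c → L c = f

/-- The number of entries smaller than `c`. -/
def gtSize (L : ℕ → ℕ → ℕ) (c : ℕ) : ℕ := ∑ a ∈ Finset.range c, L c a

namespace IsGT

variable {L : ℕ → ℕ → ℕ}

/-- Column strictness makes the entries of row `a` at least `a`. This is why the sum over `range c`
in `gtSize` sees every row. -/
theorem eq_zero (h : IsGT L) : ∀ {c a : ℕ}, c ≤ a → L c a = 0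
  | 0, a, _ => h.zero a
  | c + 1, 0, hca => by omega
  | c + 1, a + 1, hca => Nat.le_zero.mp ((h.interlace c a).trans (h.eq_zero (by omega)).le)

theorem monotone (h : IsGT L) (a : ℕ) : Monotone fun c => L c a :=
  monotone_nat_of_le_succ fun c => h.le_succ c a

theorem antitone (h : IsGT L) (c : ℕ) : Antitone (L c) :=
  antitone_nat_of_succ_le fun a => (h.le_succ c (a + 1)).trans (h.interlace c a)

theorem antitone_shape (h : IsGT L) {f : ℕ → ℕ} (hf : HasShape L f) : Antitone f := by
  obtain ⟨N, hN⟩ := hf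
  exact hN N le_rfl ▸ h.antitone N

theorem gtSize_eq (h : IsGT L) {c M : ℕ} (hM : c ≤ M) :
    gtSize L c = ∑ a ∈ Finset.range M, L c a := by
  refine Finset.sum_subset (Finset.range_subset_range.mpr hM) fun a _ ha => h.eq_zero ?_
  simpa using ha

end IsGT

/-! ### Row insertion -/

/-- The bumping route of the insertion of the letter `w`: after the letters smaller than `c` have
been treated, the bumped box is in row `insPtr L w c - 1`, or does not exist yet if
`insPtr L w c = 0`. -/
def insPtr (L : ℕ → ℕ → ℕ) (w : ℕ) : ℕ → ℕ
  | 0 => 0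
  | c + 1 =>
    match insPtr L w c with
    | 0 => if c = w then 1 else 0
    | a + 1 => if L c a < L (c + 1) a then a + 2 else a + 1

/-- Row insertion of the letter `w`. -/
def gtInsert (L : ℕ → ℕ → ℕ) (w : ℕ) (c a : ℕ) : ℕ :=
  L c a + if insPtr L w c = a + 1 then 1 else 0

/-- The four cases: `w` enters row `0`; the route has not started; an entry `c` is bumped from row
`a` to row `a + 1`; row `a` has no entry `c` and nothing is bumped. -/
theorem insPtr_succ (L : ℕ → ℕ → ℕ) (w c : ℕ) :
    (insPtr L w c = 0 ∧ c = w ∧ insPtr L w (c + 1) = 1) ∨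
    (insPtr L w c = 0 ∧ c ≠ w ∧ insPtr L w (c + 1) = 0) ∨
    (∃ a, insPtr L w c = a + 1 ∧ L c a < L (c + 1) a ∧ insPtr L w (c + 1) = a + 2) ∨
    (∃ a, insPtr L w c = a + 1 ∧ L (c + 1) a ≤ L c a ∧ insPtr L w (c + 1) = a + 1) := by
  rw [insPtr]
  rcases insPtr L w c with _ | a
  · by_cases h : c = w <;> simp [h]
  · by_cases h : L c a < L (c + 1) a
    · simp [h]
    · simpa [h] using not_lt.mp h

theorem insPtr_eq_zero_iff {L : ℕ → ℕ → ℕ} {w c : ℕ} : insPtr L w c = 0 ↔ c ≤ w := by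
  induction c with
  | zero => simp [insPtr]
  | succ c ih =>
    rcases insPtr_succ L w c with ⟨h1, h2, h3⟩ | ⟨h1, h2, h3⟩ | ⟨a, h1, h2, h3⟩ | ⟨a, h1, h2, h3⟩ <;>
      rw [h1] at ih <;> rw [h3] <;> omega

theorem insPtr_le (L : ℕ → ℕ → ℕ) (w c : ℕ) : insPtr L w c ≤ c := by
  induction c with
  | zero => simp [insPtr]
  | succ c ih =>
    rcases insPtr_succ L w c with ⟨h1, h2, h3⟩ | ⟨h1, h2, h3⟩ | ⟨a, h1, h2, h3⟩ | ⟨a, h1, h2, h3⟩ <;>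
      omega

/-- When the route enters row `a + 1`, row `a` has just grown, while interlacing bounds row `a + 1`
by the old length of row `a`. As long as the route stays, row `a + 1` does not grow, so the gap
persists. -/
theorem IsGT.addable {L : ℕ → ℕ → ℕ} (h : IsGT L) (w : ℕ) {c a : ℕ}
    (hp : insPtr L w c = a + 2) : L c (a + 1) < L c a := by
  induction c with
  | zero => simp [insPtr] at hp
  | succ c ih =>
    have h1 := h.interlace c a
    have h2 := h.le_succ c a
    rcases insPtr_succ L w c with ⟨h4, h5, h6⟩ | ⟨h4, h5, h6⟩ | ⟨b, h4, h5, h6⟩ | ⟨b, h4, h5, h6⟩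
    · omega
    · omega
    · obtain rfl : b = a := by omega
      omega
    · obtain rfl : b = a + 1 := by omega
      have := ih h4
      omega

/-- The extra box could break monotonicity in `c` only when the route leaves a row, which then grows
strictly in `L`; it could break interlacing only when the route stays in a row other than the first,
where `addable` leaves room. -/
theorem IsGT.insert {L : ℕ → ℕ → ℕ} (h : IsGT L) (w : ℕ) : IsGT (gtInsert L w) where
  zero a := by simp [gtInsert, h.zero, insPtr]
  le_succ c a := by
    have h1 := h.le_succ c a
    simp only [gtInsert]
    rcases insPtr_succ L w c with ⟨h4, h5, h6⟩ | ⟨h4, h5, h6⟩ | ⟨b, h4, h5, h6⟩ | ⟨b, h4, h5, h6⟩ <;>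
      rw [h4, h6]
    · split_ifs <;> first | omega | contradiction
    · split_ifs <;> omega
    · by_cases hb : b = a
      · subst hb; split_ifs <;> omega
      · split_ifs <;> omega
    · split_ifs <;> omega
  interlace c a := by
    have h1 := h.interlace c a
    simp only [gtInsert]
    rcases insPtr_succ L w c with ⟨h4, h5, h6⟩ | ⟨h4, h5, h6⟩ | ⟨b, h4, h5, h6⟩ | ⟨b, h4, h5, h6⟩ <;>
      rw [h4, h6]
    · split_ifs <;> omega
    · split_ifs <;> omega
    · split_ifs <;> omega
    · by_cases hb : b = a + 1
      · subst hb
        have := h.addable w h4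
        split_ifs <;> omega
      · split_ifs <;> omega

/-- The row in which the bumping route ends. -/
noncomputable def endRow (L : ℕ → ℕ → ℕ) (w : ℕ) : ℕ :=
  Classical.epsilon fun a => ∃ N, ∀ c, N ≤ c → insPtr L w c = a + 1

/-- Beyond `N` no row grows, so nothing more is bumped; beyond `w` the route has started. -/
theorem exists_insPtr_eq_endRow {L : ℕ → ℕ → ℕ} {f : ℕ → ℕ} (hf : HasShape L f) (w : ℕ) :
    ∃ N, ∀ c, N ≤ c → insPtr L w c = endRow L w + 1 := by
  refine Classical.epsilon_spec (p := fun a => ∃ N, ∀ c, N ≤ c → insPtr L w c = a + 1) ?_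
  obtain ⟨N, hN⟩ := hf
  have h0 : insPtr L w (max N (w + 1)) ≠ 0 := by
    rw [Ne, insPtr_eq_zero_iff]; omega
  obtain ⟨a, ha⟩ := Nat.exists_eq_succ_of_ne_zero h0
  refine ⟨a, max N (w + 1), fun c hc => ?_⟩
  induction c, hc using Nat.le_induction with
  | base => exact ha
  | succ c hc ih =>
    have h1 : L (c + 1) = L c := by rw [hN c (by omega), hN (c + 1) (by omega)]
    rcases insPtr_succ L w c with ⟨h4, h5, h6⟩ | ⟨h4, h5, h6⟩ | ⟨b, h4, h5, h6⟩ | ⟨b, h4, h5, h6⟩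
    · omega
    · omega
    · rw [h1] at h5; omega
    · omega

theorem endRow_eq {L : ℕ → ℕ → ℕ} {f : ℕ → ℕ} (hf : HasShape L f) {w a N : ℕ}
    (h : ∀ c, N ≤ c → insPtr L w c = a + 1) : endRow L w = a := by
  obtain ⟨M, hM⟩ := exists_insPtr_eq_endRow hf w
  have h1 := h _ (le_max_left N M)
  have h2 := hM _ (le_max_right N M)
  omega

theorem HasShape.insert {L : ℕ → ℕ → ℕ} {f : ℕ → ℕ} (hf : HasShape L f) (w : ℕ) :
    HasShape (gtInsert L w) fun a => f a + if endRow L w = a then 1 else 0 := by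
  obtain ⟨M, hM⟩ := exists_insPtr_eq_endRow hf w
  obtain ⟨N, hN⟩ := hf
  refine ⟨max N M, fun c hc => ?_⟩
  funext a
  rw [gtInsert, hM c (by omega), hN c (by omega)]
  simp

/-- Above level `w` the route carries exactly one extra box, and `insPtr_le` puts its row in `range
c`. -/
theorem gtSize_insert (L : ℕ → ℕ → ℕ) (w c : ℕ) :
    gtSize (gtInsert L w) c = gtSize L c + if w < c then 1 else 0 := by
  simp only [gtSize, gtInsert, Finset.sum_add_distrib]
  congr 1
  have h1 := insPtr_eq_zero_iff (L := L) (w := w) (c := c)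
  have h2 := insPtr_le L w c
  rcases hp : insPtr L w c with _ | b
  · rw [hp] at h1
    rw [if_neg (by omega)]
    simp
  · rw [hp] at h1 h2
    rw [if_pos (by omega)]
    simp only [Nat.add_right_cancel_iff]
    rw [Finset.sum_ite_eq, if_pos (Finset.mem_range.mpr (by omega))]

/-! ### Bumping routes of two successive insertions -/

/-- Row bumping lemma, weak case. To get ahead, the second route would have to leave a common row
where the first one stays. Both levels of that row then have the same added box, so the row does not
grow and nothing is bumped. -/
theorem insPtr_insert_le {L : ℕ → ℕ → ℕ} {w w' : ℕ} (hw : w ≤ w') (c : ℕ) :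
    insPtr (gtInsert L w) w' c ≤ insPtr L w c := by
  induction c with
  | zero => simp [insPtr]
  | succ c ih =>
    rcases insPtr_succ L w c with ⟨h4, h5, h6⟩ | ⟨h4, h5, h6⟩ | ⟨b, h4, h5, h6⟩ | ⟨b, h4, h5, h6⟩ <;>
    rcases insPtr_succ (gtInsert L w) w' c with
      ⟨k4, k5, k6⟩ | ⟨k4, k5, k6⟩ | ⟨e, k4, k5, k6⟩ | ⟨e, k4, k5, k6⟩ <;> try omega
    · have := insPtr_eq_zero_iff (L := L) (w := w) (c := c)
      omega
    · by_cases hbe : e = b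
      · subst hbe
        simp only [gtInsert, h4, h6] at k5
        simp only [if_true] at k5
        omega
      · omega

/-- Row bumping lemma, strict case. If the first route enters the row of the second, that row grows
in the new pattern and the second route is pushed further down. -/
theorem IsGT.insPtr_lt_insert {L : ℕ → ℕ → ℕ} (h : IsGT L) {w w' : ℕ} (hw : w' < w) {c : ℕ} (hc : w' < c) :
    insPtr L w c < insPtr (gtInsert L w) w' c := by
  induction c with
  | zero => omega
  | succ c ih =>
    have z := insPtr_eq_zero_iff (L := L) (w := w) (c := c)
    have z' := insPtr_eq_zero_iff (L := gtInsert L w) (w := w') (c := c)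
    have zs := insPtr_eq_zero_iff (L := L) (w := w) (c := c + 1)
    rcases insPtr_succ (gtInsert L w) w' c with
      ⟨k4, k5, k6⟩ | ⟨k4, k5, k6⟩ | ⟨e, k4, k5, k6⟩ | ⟨e, k4, k5, k6⟩
    · omega
    · omega
    · have := ih (by omega)
      rcases insPtr_succ L w c with
        ⟨h4, h5, h6⟩ | ⟨h4, h5, h6⟩ | ⟨b, h4, h5, h6⟩ | ⟨b, h4, h5, h6⟩ <;> omega
    · have := ih (by omega)
      rcases insPtr_succ L w c with
        ⟨h4, h5, h6⟩ | ⟨h4, h5, h6⟩ | ⟨b, h4, h5, h6⟩ | ⟨b, h4, h5, h6⟩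
      · by_cases he : e = 0
        · subst he
          have := h.le_succ c 0
          simp only [gtInsert, h4, h6] at k5
          simp only [zero_add, if_true, zero_ne_one, if_false] at k5
          omega
        · omega
      · omega
      · by_cases hbe : e = b + 1
        · subst hbe
          have := h.le_succ c (b + 1)
          simp only [gtInsert, h4, h6] at k5
          simp only [if_true, Nat.left_eq_add, one_ne_zero, if_false] at k5
          omega
        · omega
      · omega

/-! ### Reverse insertion -/

/-- One step of the reverse bumping route. -/
def revStep (L : ℕ → ℕ → ℕ) (c : ℕ) : ℕ → ℕ
  | 0 => 0
  | a + 1 => if L c a < L (c + 1) a then a else a + 1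

theorem revStep_cases (L : ℕ → ℕ → ℕ) (c b : ℕ) :
    (b = 0 ∧ revStep L c b = 0) ∨
    (∃ a, b = a + 1 ∧ L c a < L (c + 1) a ∧ revStep L c b = a) ∨
    (∃ a, b = a + 1 ∧ L (c + 1) a ≤ L c a ∧ revStep L c b = a + 1) := by
  rcases b with _ | a
  · simp [revStep]
  · by_cases h : L c a < L (c + 1) a
    · simp [revStep, h]
    · simpa [revStep, h] using not_lt.mp h

/-- In the new pattern the row of the route grows exactly when the route has just entered it, so the
previous position can be recovered. -/
theorem IsGT.revStep_insert {L : ℕ → ℕ → ℕ} (h : IsGT L) (w c : ℕ) :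
    revStep (gtInsert L w) c (insPtr L w (c + 1)) = insPtr L w c := by
  rcases insPtr_succ L w c with ⟨h4, h5, h6⟩ | ⟨h4, h5, h6⟩ | ⟨b, h4, h5, h6⟩ | ⟨b, h4, h5, h6⟩ <;>
    rw [h6, revStep]
  · have := h.le_succ c 0
    rw [if_pos, h4]
    simp only [gtInsert, h4, h6]
    simp only [zero_add, if_true, zero_ne_one, if_false]
    omega
  · rw [h4]
  · have := h.le_succ c (b + 1)
    rw [if_pos, h4]
    simp only [gtInsert, h4, h6]
    simp only [if_true, Nat.left_eq_add, one_ne_zero, if_false]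
    omega
  · rw [if_neg, h4]
    simp only [gtInsert, h4, h6, if_true]
    omega

/-- Insertion is injective. -/
theorem IsGT.insert_inj {L M : ℕ → ℕ → ℕ} {f g : ℕ → ℕ} (hL : IsGT L) (hM : IsGT M)
    (hf : HasShape L f) (hg : HasShape M g) {w x : ℕ} (h : gtInsert L w = gtInsert M x)
    (hrow : endRow L w = endRow M x) : L = M ∧ w = x := by
  have hptr : ∀ c, insPtr L w c = insPtr M x c := by
    obtain ⟨N, hN⟩ := exists_insPtr_eq_endRow hf w
    obtain ⟨K, hK⟩ := exists_insPtr_eq_endRow hg x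
    -- Downward induction on the level, starting where both routes have reached their common end
    -- row.
    have key : ∀ m c, max N K ≤ c + m → insPtr L w c = insPtr M x c := by
      intro m
      induction m with
      | zero => intro c hc; rw [hN c (by omega), hK c (by omega), hrow]
      | succ m ih =>
        intro c hc
        rw [← hL.revStep_insert, ← hM.revStep_insert, ih (c + 1) (by omega), h]
    exact fun c => key (max N K) c (by omega)
  constructor
  · funext c a
    have := congrFun (congrFun h c) a
    simpa [gtInsert, hptr] using this
  · have h1 := insPtr_eq_zero_iff (L := L) (w := w) (c := w)
    have h2 := insPtr_eq_zero_iff (L := L) (w := w) (c := x)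
    have h3 := insPtr_eq_zero_iff (L := M) (w := x) (c := x)
    have h4 := insPtr_eq_zero_iff (L := M) (w := x) (c := w)
    rw [hptr] at h1 h2
    omega

/-- The recursion runs downwards: `g k` is the position at level `N - k`. From `N` on the rows are
constant, so `revStep` does not move. -/
theorem exists_reverse_route {L : ℕ → ℕ → ℕ} {f : ℕ → ℕ} (hf : HasShape L f) (a : ℕ) :
    ∃ r : ℕ → ℕ, (∃ N, ∀ c, N ≤ c → L c = f ∧ r c = a + 1) ∧
      ∀ c, r c = revStep L c (r (c + 1)) := by
  obtain ⟨N, hN⟩ := hf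
  let g : ℕ → ℕ := fun k => Nat.rec (a + 1) (fun k b => revStep L (N - (k + 1)) b) k
  refine ⟨fun c => g (N - c), ⟨N, fun c hc => ⟨hN c hc, by simp [g, Nat.sub_eq_zero_of_le hc]⟩⟩,
    fun c => ?_⟩
  rcases lt_or_ge c N with hc | hc
  · have h1 : N - c = N - (c + 1) + 1 := by omega
    have h2 : N - (N - (c + 1) + 1) = c := by omega
    show g (N - c) = revStep L c (g (N - (c + 1)))
    rw [h1]
    show revStep L (N - (N - (c + 1) + 1)) (g (N - (c + 1))) = _
    rw [h2]
  · simp [g, Nat.sub_eq_zero_of_le hc, Nat.sub_eq_zero_of_le (hc.trans (Nat.le_succ c)), revStep,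
      hN c hc, hN (c + 1) (by omega)]

/-- Every removable box can be removed by a reverse insertion. -/
theorem IsGT.exists_insert_eq {L : ℕ → ℕ → ℕ} {f : ℕ → ℕ} (hL : IsGT L) (hf : HasShape L f)
    {a : ℕ} (ha : f (a + 1) < f a) :
    ∃ (M : ℕ → ℕ → ℕ) (w : ℕ), IsGT M ∧ HasShape M (fun b => f b - if a = b then 1 else 0) ∧
      gtInsert M w = L ∧ endRow M w = a := by
  obtain ⟨r, ⟨N, hN⟩, hr⟩ := exists_reverse_route hf a
  -- At every level the route sits on a removable box; this is what keeps `M` a pattern below.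
  have hrem : ∀ c b, r c = b + 1 → L c (b + 1) < L c b := by
    have key : ∀ m c, N ≤ c + m → ∀ b, r c = b + 1 → L c (b + 1) < L c b := by
      intro m
      induction m with
      | zero =>
        intro c hc b hb
        obtain ⟨h1, h2⟩ := hN c hc
        obtain rfl : b = a := by omega
        rwa [h1]
      | succ m ih =>
        intro c hc b hb
        have ih := ih (c + 1) (by omega)
        have hrc := hr c
        rcases revStep_cases L c (r (c + 1)) with ⟨h1, h2⟩ | ⟨e, h1, h2, h3⟩ | ⟨e, h1, h2, h3⟩
        · omega
        · obtain rfl : e = b + 1 := by omega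
          have := ih _ h1
          have := hL.interlace c b
          omega
        · obtain rfl : e = b := by omega
          have := ih _ h1
          have := hL.le_succ c (e + 1)
          omega
    exact fun c => key N c (by omega)
  have hr0 : r 0 = 0 := by
    by_contra h
    obtain ⟨b, hb⟩ := Nat.exists_eq_succ_of_ne_zero h
    have := hrem 0 b hb
    rw [hL.zero, hL.zero] at this
    omega
  have hle : ∀ c, r c ≤ r (c + 1) := by
    intro c
    have hrc := hr c
    rcases revStep_cases L c (r (c + 1)) with ⟨h1, h2⟩ | ⟨e, h1, h2, h3⟩ | ⟨e, h1, h2, h3⟩ <;> omega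
  have hmono := monotone_nat_of_le_succ hle
  have hex : ∃ w, r (w + 1) ≠ 0 := ⟨N, by rw [(hN (N + 1) (by omega)).2]; omega⟩
  classical
  -- The expelled letter is the last level at which the reverse route has already left the diagram.
  let w := Nat.find hex
  have hw1 : r (w + 1) ≠ 0 := Nat.find_spec hex
  have hw0 : r w = 0 := by
    rcases hw : w with _ | w'
    · exact hr0
    · by_contra h
      exact Nat.find_min hex (m := w') (by change w' < w; omega) h
  have hwz : ∀ c, r c = 0 ↔ c ≤ w := by
    intro c
    constructor
    · intro h
      by_contra hc
      have := hmono (show w + 1 ≤ c by omega)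
      omega
    · intro h
      have := hmono h
      omega
  let M : ℕ → ℕ → ℕ := fun c b => L c b - if r c = b + 1 then 1 else 0
  -- The truncated subtraction in `M` loses nothing, because the removed box exists by `hrem`.
  have hM : ∀ c b, M c b + (if r c = b + 1 then 1 else 0) = L c b := by
    intro c b
    simp only [M]
    split_ifs with h
    · have := hrem c b h; omega
    · omega
  have hptr : ∀ c, insPtr M w c = r c := by
    intro c
    induction c with
    | zero => rw [hr0, insPtr]
    | succ c ih =>
      have hrc := hr c
      have z1 := hwz c
      have z2 := hwz (c + 1)
      rcases insPtr_succ M w c with ⟨h4, h5, h6⟩ | ⟨h4, h5, h6⟩ | ⟨b, h4, h5, h6⟩ | ⟨b, h4, h5, h6⟩ <;>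
      rcases revStep_cases L c (r (c + 1)) with ⟨h1, h2⟩ | ⟨e, h1, h2, h3⟩ | ⟨e, h1, h2, h3⟩ <;>
      try omega
      · obtain rfl : e = b := by omega
        have m1 := hM c e
        have m2 := hM (c + 1) e
        rw [if_pos (by omega)] at m1 m2
        omega
      · obtain rfl : e = b + 1 := by omega
        have m1 := hM c b
        have m2 := hM (c + 1) b
        have := hL.le_succ c b
        rw [if_pos (by omega)] at m1
        rw [if_neg (by omega)] at m2
        omega
  have hins : gtInsert M w = L := by
    funext c b
    rw [gtInsert, hptr, hM]
  have hshape : HasShape M (fun b => f b - if a = b then 1 else 0) := by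
    refine ⟨N, fun c hc => funext fun b => ?_⟩
    obtain ⟨h1, h2⟩ := hN c hc
    simp only [M, h1, h2, Nat.add_right_cancel_iff]
  refine ⟨M, w, ⟨fun b => ?_, fun c b => ?_, fun c b => ?_⟩, hshape, hins, ?_⟩
  · simp [M, hL.zero]
  · have m1 := hM c b
    have m2 := hM (c + 1) b
    have := hL.le_succ c b
    have hrc := hr c
    rcases revStep_cases L c (r (c + 1)) with ⟨h1, h2⟩ | ⟨e, h1, h2, h3⟩ | ⟨e, h1, h2, h3⟩
    · rw [if_neg (by omega)] at m1 m2
      omega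
    · by_cases hbe : e = b
      · subst hbe
        split_ifs at m1 m2 <;> omega
      · rw [if_neg (by omega)] at m2
        omega
    · split_ifs at m1 m2 <;> omega
  · have m1 := hM c b
    have m2 := hM (c + 1) (b + 1)
    have := hL.interlace c b
    have hrc := hr c
    rcases revStep_cases L c (r (c + 1)) with ⟨h1, h2⟩ | ⟨e, h1, h2, h3⟩ | ⟨e, h1, h2, h3⟩
    · rw [if_neg (by omega)] at m1
      omega
    · split_ifs at m1 m2 <;> omega
    · by_cases hbe : e = b
      · subst hbe
        have := hrem (c + 1) e h1
        split_ifs at m1 m2 <;> omega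
      · rw [if_neg (by omega)] at m1
        omega
  · exact endRow_eq hshape (N := N) fun c hc => by rw [hptr, (hN c hc).2]

/-! ### The Robinson–Schensted–Knuth correspondence -/

/-- The insertion pattern of the first letters of a word. -/
def rskP (t : ℕ → ℕ) : ℕ → ℕ → ℕ → ℕ
  | 0 => fun _ _ => 0
  | i + 1 => gtInsert (rskP t i) (t i)

/-- The row of the box created by the `i`-th insertion. -/
noncomputable def rskQ (t : ℕ → ℕ) (i : ℕ) : ℕ := endRow (rskP t i) (t i)

/-- The number of letters `a` among the first `m` letters of `q`. -/
def letterCount (q : ℕ → ℕ) (m a : ℕ) : ℕ := ((Finset.range m).filter fun i => q i = a).card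

theorem letterCount_zero (q : ℕ → ℕ) (a : ℕ) : letterCount q 0 a = 0 := by simp [letterCount]

theorem letterCount_succ (q : ℕ → ℕ) (m a : ℕ) :
    letterCount q (m + 1) a = letterCount q m a + if q m = a then 1 else 0 := by
  rw [letterCount, letterCount, Finset.range_add_one, Finset.filter_insert]
  split_ifs
  · rw [Finset.card_insert_of_notMem (by simp)]
  · simp

theorem letterCount_congr {q q' : ℕ → ℕ} {m : ℕ} (h : ∀ i < m, q i = q' i) :
    letterCount q m = letterCount q' m := by
  funext a
  refine congrArg _ (Finset.filter_congr fun i hi => ?_)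
  rw [h i (Finset.mem_range.mp hi)]

theorem rskP_congr {t t' : ℕ → ℕ} {m : ℕ} (h : ∀ i < m, t i = t' i) : rskP t m = rskP t' m := by
  induction m with
  | zero => rfl
  | succ m ih => rw [rskP, rskP, ih fun i hi => h i (by omega), h m (by omega)]

theorem rskQ_congr {t t' : ℕ → ℕ} {m : ℕ} (h : ∀ i ≤ m, t i = t' i) : rskQ t m = rskQ t' m := by
  rw [rskQ, rskQ, rskP_congr fun i hi => h i hi.le, h m le_rfl]

theorem isGT_rskP (t : ℕ → ℕ) (m : ℕ) : IsGT (rskP t m) := by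
  induction m with
  | zero => exact ⟨fun _ => rfl, fun _ _ => le_rfl, fun _ _ => le_rfl⟩
  | succ m ih => exact ih.insert _

theorem hasShape_rskP (t : ℕ → ℕ) (m : ℕ) : HasShape (rskP t m) (letterCount (rskQ t) m) := by
  induction m with
  | zero => exact ⟨0, fun c _ => funext fun a => (letterCount_zero _ a).symm⟩
  | succ m ih =>
    have : letterCount (rskQ t) (m + 1) = fun a =>
        letterCount (rskQ t) m a + if endRow (rskP t m) (t m) = a then 1 else 0 :=
      funext fun a => letterCount_succ _ m a
    rw [this]
    exact ih.insert (t m)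

theorem antitone_letterCount_rskQ (t : ℕ → ℕ) (m : ℕ) : Antitone (letterCount (rskQ t) m) :=
  (isGT_rskP t m).antitone_shape (hasShape_rskP t m)

theorem gtSize_rskP_succ (t : ℕ → ℕ) (m c : ℕ) :
    gtSize (rskP t m) (c + 1) = gtSize (rskP t m) c + letterCount t m c := by
  induction m with
  | zero => simp [rskP, gtSize, letterCount]
  | succ m ih =>
    rw [rskP, gtSize_insert, gtSize_insert, ih, letterCount_succ]
    split_ifs <;> omega

theorem rsk_injective {t t' : ℕ → ℕ} {m : ℕ} (hP : rskP t m = rskP t' m)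
    (hQ : ∀ i < m, rskQ t i = rskQ t' i) : ∀ i < m, t i = t' i := by
  induction m with
  | zero => intro i hi; omega
  | succ m ih =>
    obtain ⟨h1, h2⟩ := (isGT_rskP t m).insert_inj (isGT_rskP t' m) (hasShape_rskP t m)
      (hasShape_rskP t' m) hP (hQ m (by omega))
    intro i hi
    rcases Nat.lt_succ_iff_lt_or_eq.mp hi with hi | rfl
    · exact ih h1 (fun i hi => hQ i (by omega)) i hi
    · exact h2

theorem rsk_surjective {q : ℕ → ℕ} {m : ℕ} (hq : ∀ i ≤ m, Antitone (letterCount q i))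
    {L : ℕ → ℕ → ℕ} (hL : IsGT L) (hs : HasShape L (letterCount q m)) :
    ∃ t, rskP t m = L ∧ ∀ i < m, rskQ t i = q i := by
  induction m generalizing L with
  | zero =>
    refine ⟨fun _ => 0, ?_, fun i hi => by omega⟩
    obtain ⟨N, hN⟩ := hs
    funext c a
    have h1 := hL.monotone a (le_max_left c N)
    simp only [hN _ (le_max_right c N), letterCount_zero] at h1
    simp only [rskP]
    omega
  | succ m ih =>
    -- The last letter is a removable row: before it was read, row `q m` was at least as long as the
    -- next one, and it alone gained a box.
    have hrem : letterCount q (m + 1) (q m + 1) < letterCount q (m + 1) (q m) := by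
      have := hq m (by omega) (Nat.le_succ (q m))
      rw [letterCount_succ, letterCount_succ, if_pos rfl, if_neg (by omega)]
      simp only [Nat.succ_eq_add_one] at this
      omega
    obtain ⟨M, w, hM, hMs, hins, hend⟩ := hL.exists_insert_eq hs hrem
    have hMs' : HasShape M (letterCount q m) := by
      convert hMs using 1
      funext a
      rw [letterCount_succ]
      omega
    obtain ⟨t, ht, htq⟩ := ih (fun i hi => hq i (by omega)) hM hMs'
    have hup : ∀ i < m, Function.update t m w i = t i := fun i hi =>
      Function.update_of_ne (by omega) _ _
    have hP : rskP (Function.update t m w) m = M := by rw [rskP_congr hup, ht]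
    refine ⟨Function.update t m w, ?_, fun i hi => ?_⟩
    · rw [rskP, hP, Function.update_self, hins]
    · rcases Nat.lt_succ_iff_lt_or_eq.mp hi with hi | rfl
      · rw [rskQ_congr fun j hj => hup j (by omega), htq i hi]
      · rw [rskQ, hP, Function.update_self, hend]

/-- Descents of a word are the descents of its recording tableau. -/
theorem rskQ_lt_succ_iff (t : ℕ → ℕ) (i : ℕ) : rskQ t i < rskQ t (i + 1) ↔ t (i + 1) < t i := by
  obtain ⟨N, hN⟩ := exists_insPtr_eq_endRow (hasShape_rskP t i) (t i)
  obtain ⟨M, hM⟩ := exists_insPtr_eq_endRow (hasShape_rskP t (i + 1)) (t (i + 1))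
  -- A level where both routes have ended and the second letter has been inserted, as the strict
  -- bumping lemma requires.
  let c := max (max N M) (t (i + 1) + 1)
  have h1 : insPtr (rskP t i) (t i) c = rskQ t i + 1 := hN c (by omega)
  have h2 : insPtr (gtInsert (rskP t i) (t i)) (t (i + 1)) c = rskQ t (i + 1) + 1 :=
    hM c (by omega)
  constructor
  · intro h
    by_contra hlt
    have := insPtr_insert_le (L := rskP t i) (not_lt.mp hlt) c
    omega
  · intro h
    have := (isGT_rskP t i).insPtr_lt_insert h (c := c) (by omega)
    omega

/-! ### Semistandard tableaux as Gelfand–Tsetlin patterns -/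

/-- The Gelfand–Tsetlin patterns of shape `f`. -/
def GTPattern (f : ℕ → ℕ) : Type := {L : ℕ → ℕ → ℕ // IsGT L ∧ HasShape L f}

/-- The exponent vector of the monomial of a tableau. -/
noncomputable def ssytWeight {lam : YoungDiagram} (T : SemistandardYoungTableau lam) : ℕ →₀ ℕ :=
  ∑ c ∈ lam.cells, Finsupp.single (T c.1 c.2) 1

theorem ssytWeight_apply {lam : YoungDiagram} (T : SemistandardYoungTableau lam) (c : ℕ) :
    ssytWeight T c = (lam.cells.filter fun x => T x.1 x.2 = c).card := by
  simp [ssytWeight, Finsupp.finsetSum_apply, Finsupp.single_apply]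

/-- Counting by rows shows that `gtSize L c` is the number of cells with entry below `c`; successive
differences give the weight. -/
theorem IsGT.gtSize_succ_of_tableau {L : ℕ → ℕ → ℕ} (h : IsGT L) {lam : YoungDiagram}
    (T : SemistandardYoungTableau lam)
    (hT : ∀ c a j, j < L c a ↔ (a, j) ∈ lam ∧ T a j < c) (c : ℕ) :
    gtSize L (c + 1) = gtSize L c + ssytWeight T c := by
  have key : ∀ c, gtSize L c = (lam.cells.filter fun x => T x.1 x.2 < c).card := by
    intro c
    rw [Finset.card_eq_sum_card_fiberwise (f := Prod.fst) (t := Finset.range c)]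
    · refine Finset.sum_congr rfl fun a _ => ?_
      have : ((lam.cells.filter fun x => T x.1 x.2 < c).filter fun x => x.1 = a) =
          (Finset.range (L c a)).image (Prod.mk a) := by
        ext ⟨i, j⟩
        simp only [Finset.mem_filter, YoungDiagram.mem_cells, Finset.mem_image, Finset.mem_range,
          Prod.mk.injEq]
        constructor
        · rintro ⟨h1, rfl⟩
          exact ⟨j, (hT c i j).mpr h1, rfl, rfl⟩
        · rintro ⟨j', h1, rfl, rfl⟩
          exact ⟨(hT c a j').mp h1, rfl⟩
      rw [this, Finset.card_image_of_injective _ (Prod.mk_right_injective a), Finset.card_range]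
    · rintro ⟨i, j⟩ hx
      simp only [Finset.coe_filter, YoungDiagram.mem_cells, Set.mem_ofPred_eq] at hx
      simp only [Finset.coe_range, Set.mem_Iio]
      by_contra hi
      have := (hT c i j).mpr hx
      rw [h.eq_zero (not_lt.mp hi)] at this
      omega
  rw [key, key, ssytWeight_apply, ← Finset.card_union_of_disjoint]
  · congr 1
    ext x
    simp only [Finset.mem_filter, Finset.mem_union, Nat.lt_succ_iff_lt_or_eq]
    tauto
  · rw [Finset.disjoint_left]
    intro x hx hx'
    simp only [Finset.mem_filter] at hx hx'
    omega

theorem exists_not_rowLen_and (lam : YoungDiagram) (T : SemistandardYoungTableau lam) (c a : ℕ) :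
    ∃ j, ¬ (j < lam.rowLen a ∧ T a j < c) := ⟨lam.rowLen a, fun h => lt_irrefl _ h.1⟩

/-- The number of entries smaller than `c` in row `a` of a tableau. -/
def rowCountLT {lam : YoungDiagram} (T : SemistandardYoungTableau lam) (c a : ℕ) : ℕ :=
  Nat.find (exists_not_rowLen_and lam T c a)

/-- Since rows increase weakly, the entries below `c` form an initial segment of the row, whose
length is the first column that fails. -/
theorem lt_rowCountLT {lam : YoungDiagram} (T : SemistandardYoungTableau lam) (c a j : ℕ) :
    j < rowCountLT T c a ↔ (a, j) ∈ lam ∧ T a j < c := by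
  rw [rowCountLT, Nat.lt_find_iff]
  simp only [not_not, YoungDiagram.mem_iff_lt_rowLen]
  constructor
  · exact fun h => h j le_rfl
  · rintro ⟨h1, h2⟩ i hi
    exact ⟨by omega, (T.row_weak_of_le hi (YoungDiagram.mem_iff_lt_rowLen.mpr h1)).trans_lt h2⟩

theorem isGT_rowCountLT {lam : YoungDiagram} (T : SemistandardYoungTableau lam) :
    IsGT (rowCountLT T) where
  zero a := by
    by_contra h
    have := (lt_rowCountLT T 0 a 0).mp (Nat.pos_of_ne_zero h)
    omega
  le_succ c a := le_of_forall_lt fun j hj => by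
    rw [lt_rowCountLT] at hj ⊢
    exact ⟨hj.1, by omega⟩
  interlace c a := le_of_forall_lt fun j hj => by
    rw [lt_rowCountLT] at hj ⊢
    have := T.col_strict (Nat.lt_add_one a) hj.1
    exact ⟨lam.up_left_mem (Nat.le_succ a) le_rfl hj.1, by omega⟩

theorem hasShape_rowCountLT {lam : YoungDiagram} (T : SemistandardYoungTableau lam) :
    HasShape (rowCountLT T) lam.rowLen := by
  refine ⟨(lam.cells.sup fun x => T x.1 x.2) + 1, fun c hc => funext fun a =>
    eq_of_forall_lt_iff fun j => ?_⟩
  rw [lt_rowCountLT, ← YoungDiagram.mem_iff_lt_rowLen, and_iff_left_iff_imp]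
  intro h
  have : T a j ≤ lam.cells.sup fun x => T x.1 x.2 :=
    Finset.le_sup (f := fun x : ℕ × ℕ => T x.1 x.2) ((YoungDiagram.mem_cells _).mpr h)
  omega

theorem GTPattern.le_shape {f : ℕ → ℕ} (L : GTPattern f) (c a : ℕ) : L.1 c a ≤ f a := by
  obtain ⟨N, hN⟩ := L.2.2
  have : L.1 c a ≤ L.1 (max c N) a := L.2.1.monotone a (le_max_left c N)
  rwa [hN _ (le_max_right c N)] at this

/-- The entry in row `a` and column `j` of the tableau of a pattern. -/
noncomputable def gtEntry (L : ℕ → ℕ → ℕ) (a j : ℕ) : ℕ := sInf {c | j < L (c + 1) a}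

theorem GTPattern.lt_gtEntry_succ {f : ℕ → ℕ} (L : GTPattern f) {a j : ℕ} (h : j < f a) :
    j < L.1 (gtEntry L.1 a j + 1) a := by
  refine Nat.sInf_mem (s := {c | j < L.1 (c + 1) a}) ?_
  obtain ⟨N, hN⟩ := L.2.2
  refine ⟨N, ?_⟩
  rw [Set.mem_ofPred_eq, hN _ (Nat.le_succ N)]
  exact h

theorem GTPattern.gtEntry_lt_iff {f : ℕ → ℕ} (L : GTPattern f) {c a j : ℕ} (h : j < f a) :
    gtEntry L.1 a j < c ↔ j < L.1 c a := by
  constructor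
  · intro hc
    exact (L.lt_gtEntry_succ h).trans_le (L.2.1.monotone a hc)
  · intro hj
    rcases c with _ | c
    · rw [L.2.1.zero] at hj
      omega
    · exact Nat.lt_succ_of_le (Nat.sInf_le hj)

/-- Semistandard tableaux as Gelfand–Tsetlin patterns. -/
noncomputable def ssytEquiv (lam : YoungDiagram) :
    SemistandardYoungTableau lam ≃ GTPattern lam.rowLen where
  toFun T := ⟨rowCountLT T, isGT_rowCountLT T, hasShape_rowCountLT T⟩
  invFun L :=
    { entry := gtEntry L.1
      row_weak' := by
        intro i j₁ j₂ hj h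
        have := L.lt_gtEntry_succ (YoungDiagram.mem_iff_lt_rowLen.mp h)
        exact Nat.sInf_le (hj.trans this)
      col_strict' := by
        intro i₁ i₂ j hi h
        have h1 := L.lt_gtEntry_succ (YoungDiagram.mem_iff_lt_rowLen.mp h)
        rw [L.gtEntry_lt_iff (YoungDiagram.mem_iff_lt_rowLen.mp (lam.up_left_mem hi.le le_rfl h))]
        exact h1.trans_le ((L.2.1.antitone _ hi).trans (L.2.1.interlace _ i₁))
      zeros' := by
        intro i j h
        rw [YoungDiagram.mem_iff_lt_rowLen] at h
        -- Outside the diagram the set is empty, and `sInf ∅ = 0` matches the default entry of a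
        -- tableau.
        have : {c | j < L.1 (c + 1) i} = ∅ := by
          ext c
          have := L.le_shape (c + 1) i
          simp only [Set.mem_ofPred_eq, Set.mem_empty_iff_false, iff_false]
          omega
        rw [gtEntry, this, Nat.sInf_empty] }
  left_inv T := by
    ext a j
    let L : GTPattern lam.rowLen := ⟨rowCountLT T, isGT_rowCountLT T, hasShape_rowCountLT T⟩
    by_cases h : (a, j) ∈ lam
    · refine eq_of_forall_gt_iff fun c => ?_
      refine (L.gtEntry_lt_iff (YoungDiagram.mem_iff_lt_rowLen.mp h)).trans ?_
      simp [L, lt_rowCountLT, h]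
    · rw [SemistandardYoungTableau.zeros _ h, SemistandardYoungTableau.zeros _ h]
  right_inv L := by
    refine Subtype.ext (funext fun c => funext fun a => eq_of_forall_lt_iff fun j => ?_)
    rw [lt_rowCountLT]
    constructor
    · rintro ⟨h1, h2⟩
      exact (L.gtEntry_lt_iff (YoungDiagram.mem_iff_lt_rowLen.mp h1)).mp h2
    · intro h
      have h1 := h.trans_le (L.le_shape c a)
      exact ⟨YoungDiagram.mem_iff_lt_rowLen.mpr h1, (L.gtEntry_lt_iff h1).mpr h⟩

theorem gtSize_ssytEquiv_succ {lam : YoungDiagram} (T : SemistandardYoungTableau lam) (c : ℕ) :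
    gtSize (ssytEquiv lam T).1 (c + 1) = gtSize (ssytEquiv lam T).1 c + ssytWeight T c :=
  (isGT_rowCountLT T).gtSize_succ_of_tableau T (lt_rowCountLT T) c

theorem ssytWeight_eq {lam : YoungDiagram} {T : SemistandardYoungTableau lam} {d : ℕ →₀ ℕ}
    (h : ∀ c, gtSize (ssytEquiv lam T).1 (c + 1) = gtSize (ssytEquiv lam T).1 c + d c) :
    ssytWeight T = d := by
  ext c
  have h1 := h c
  rw [gtSize_ssytEquiv_succ] at h1
  omega

/-! ### Bender–Knuth involutions and the symmetry of Schur functions -/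

/-- The largest value allowed in level `k + 1` of a pattern by the two adjacent levels. -/
def bkUpper (L : ℕ → ℕ → ℕ) (k : ℕ) : ℕ → ℕ
  | 0 => L (k + 2) 0
  | a + 1 => min (L (k + 2) (a + 1)) (L k a)

/-- The smallest value allowed in level `k + 1` of a pattern by the two adjacent levels. -/
def bkLower (L : ℕ → ℕ → ℕ) (k a : ℕ) : ℕ := max (L k a) (L (k + 2) (a + 1))

/-- The Bender–Knuth involution reflects level `k + 1` of a pattern between its bounds. -/
def bkReflect (L : ℕ → ℕ → ℕ) (k c a : ℕ) : ℕ :=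
  if c = k + 1 then bkUpper L k a + bkLower L k a - L (k + 1) a else L c a

theorem bkReflect_self (L : ℕ → ℕ → ℕ) (k a : ℕ) :
    bkReflect L k (k + 1) a = bkUpper L k a + bkLower L k a - L (k + 1) a := if_pos rfl

theorem bkReflect_of_ne (L : ℕ → ℕ → ℕ) {k c : ℕ} (h : c ≠ k + 1) :
    bkReflect L k c = L c := funext fun _ => if_neg h

theorem bkUpper_bkReflect (L : ℕ → ℕ → ℕ) (k : ℕ) : bkUpper (bkReflect L k) k = bkUpper L k := by
  funext a
  cases a <;> simp [bkUpper, bkReflect]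

theorem bkLower_bkReflect (L : ℕ → ℕ → ℕ) (k : ℕ) : bkLower (bkReflect L k) k = bkLower L k := by
  funext a
  simp [bkLower, bkReflect]

namespace IsGT

variable {L : ℕ → ℕ → ℕ}

theorem le_bkUpper (h : IsGT L) (k a : ℕ) : L (k + 1) a ≤ bkUpper L k a := by
  cases a with
  | zero => exact h.le_succ (k + 1) 0
  | succ a => exact le_min (h.le_succ (k + 1) (a + 1)) (h.interlace k a)

theorem bkLower_le (h : IsGT L) (k a : ℕ) : bkLower L k a ≤ L (k + 1) a :=
  max_le (h.le_succ k a) (h.interlace (k + 1) a)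

theorem bkReflect (h : IsGT L) (k : ℕ) : IsGT (bkReflect L k) where
  zero a := by rw [bkReflect_of_ne L (by omega), h.zero]
  le_succ c a := by
    have h1 := h.le_bkUpper k a
    have h2 := h.bkLower_le k a
    by_cases hc : c = k + 1
    · subst hc
      rw [bkReflect_self, bkReflect_of_ne L (by omega)]
      have : bkUpper L k a ≤ L (k + 2) a := by
        cases a
        · exact le_rfl
        · exact min_le_left _ _
      show _ ≤ L (k + 2) a
      omega
    · by_cases hc' : c = k
      · subst hc'
        rw [bkReflect_self, bkReflect_of_ne L (by omega)]
        have : L c a ≤ bkLower L c a := le_max_left _ _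
        omega
      · rw [bkReflect_of_ne L hc, bkReflect_of_ne L (by omega)]
        exact h.le_succ c a
  interlace c a := by
    by_cases hc : c = k + 1
    · subst hc
      have h1 := h.le_bkUpper k a
      have h2 := h.bkLower_le k a
      rw [bkReflect_self, bkReflect_of_ne L (by omega)]
      have : L (k + 2) (a + 1) ≤ bkLower L k a := le_max_right _ _
      show L (k + 2) (a + 1) ≤ _
      omega
    · by_cases hc' : c = k
      · subst hc'
        have h1 := h.le_bkUpper c (a + 1)
        have h2 := h.bkLower_le c (a + 1)
        rw [bkReflect_self, bkReflect_of_ne L (by omega)]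
        have : bkUpper L c (a + 1) ≤ L c a := min_le_right _ _
        omega
      · rw [bkReflect_of_ne L hc, bkReflect_of_ne L (by omega)]
        exact h.interlace c a

theorem bkReflect_bkReflect (h : IsGT L) (k : ℕ) :
    GridClasses.bkReflect (GridClasses.bkReflect L k) k = L := by
  funext c a
  by_cases hc : c = k + 1
  · subst hc
    rw [bkReflect_self, bkReflect_self, bkUpper_bkReflect, bkLower_bkReflect]
    have h1 := h.le_bkUpper k a
    have h2 := h.bkLower_le k a
    omega
  · rw [bkReflect_of_ne _ hc, bkReflect_of_ne _ hc]

/-- Reflection replaces a row length by the sum of its bounds minus itself. The upper bound of row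
`a + 1` and the lower bound of row `a` are the minimum and maximum of the same two numbers, so the
bounds add up to the sizes of the adjacent levels. -/
theorem gtSize_bkReflect (h : IsGT L) (k : ℕ) :
    gtSize (GridClasses.bkReflect L k) (k + 1) + gtSize L (k + 1) =
      gtSize L k + gtSize L (k + 2) := by
  rw [(h.bkReflect k).gtSize_eq (M := k + 3) (by omega), h.gtSize_eq (c := k + 1) (M := k + 3)
    (by omega), h.gtSize_eq (c := k) (M := k + 2) (by omega),
    h.gtSize_eq (c := k + 2) (M := k + 3) (by omega), ← Finset.sum_add_distrib]
  have h1 : ∀ a ∈ Finset.range (k + 3),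
      GridClasses.bkReflect L k (k + 1) a + L (k + 1) a = bkUpper L k a + bkLower L k a := by
    intro a _
    have h1 := h.le_bkUpper k a
    have h2 := h.bkLower_le k a
    rw [bkReflect_self]
    omega
  have h2 : bkLower L k (k + 2) = 0 := by
    simp [bkLower, h.eq_zero]
  have h3 : ∀ a, bkUpper L k (a + 1) + bkLower L k a = L k a + L (k + 2) (a + 1) := by
    intro a
    simp only [bkUpper, bkLower]
    omega
  rw [Finset.sum_congr rfl h1, Finset.sum_add_distrib, Finset.sum_range_succ',
    Finset.sum_range_succ (bkLower L k), h2, Finset.sum_range_succ' (L (k + 2))]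
  have h4 := Finset.sum_congr rfl fun a (_ : a ∈ Finset.range (k + 2)) => h3 a
  rw [Finset.sum_add_distrib, Finset.sum_add_distrib] at h4
  simp only [bkUpper] at h4 ⊢
  omega

/-- Reflecting the size at level `k + 1` between its neighbours exchanges the two differences around
it, the multiplicities of `k` and `k + 1`. -/
theorem gtSize_bkReflect_succ (h : IsGT L) (k : ℕ) {d : ℕ → ℕ}
    (hd : ∀ c, gtSize L (c + 1) = gtSize L c + d c) (c : ℕ) :
    gtSize (GridClasses.bkReflect L k) (c + 1) =
      gtSize (GridClasses.bkReflect L k) c + d (Equiv.swap k (k + 1) c) := by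
  have h1 := h.gtSize_bkReflect k
  have hk := hd k
  have hk' : gtSize L (k + 2) = gtSize L (k + 1) + d (k + 1) := hd (k + 1)
  have hne : ∀ c, c ≠ k + 1 → gtSize (GridClasses.bkReflect L k) c = gtSize L c := fun c hc => by
    rw [gtSize, bkReflect_of_ne L hc, gtSize]
  by_cases hc : c = k
  · subst hc
    rw [Equiv.swap_apply_left, hne c (by omega)]
    omega
  · by_cases hc' : c = k + 1
    · subst hc'
      rw [Equiv.swap_apply_right, hne (k + 1 + 1) (by omega)]
      show gtSize L (k + 2) = _
      omega
    · rw [Equiv.swap_apply_of_ne_of_ne hc hc', hne c hc', hne (c + 1) (by omega)]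
      exact hd c

end IsGT

/-- The Bender–Knuth involution on the patterns of a given shape. -/
def bkEquiv (f : ℕ → ℕ) (k : ℕ) : GTPattern f ≃ GTPattern f :=
  Function.Involutive.toPerm
    (fun L => ⟨bkReflect L.1 k, L.2.1.bkReflect k, by
      obtain ⟨N, hN⟩ := L.2.2
      exact ⟨max N (k + 2), fun c hc => by
        rw [bkReflect_of_ne L.1 (by omega), hN c (by omega)]⟩⟩)
    fun L => Subtype.ext (L.2.1.bkReflect_bkReflect k)

theorem coeff_monomialSum_mapDomain {ι : Type*} {a : ι → ℕ →₀ ℕ} {σ : Equiv.Perm ℕ} (e : ι ≃ ι)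
    (h : ∀ i, a (e i) = (a i).mapDomain σ) (d : ℕ →₀ ℕ) :
    MvPowerSeries.coeff (d.mapDomain σ) (monomialSum a) =
      MvPowerSeries.coeff d (monomialSum a) := by
  simp only [monomialSum, MvPowerSeries.coeff_apply]
  refine congrArg _ (Nat.card_congr (e.subtypeEquiv fun i => ?_)).symm
  rw [h, (Finsupp.mapDomain_injective σ.injective).eq_iff]

theorem coeff_schur_mapDomain_swap (lam : YoungDiagram) (k : ℕ) (d : ℕ →₀ ℕ) :
    MvPowerSeries.coeff (d.mapDomain (Equiv.swap k (k + 1))) (schur lam) =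
      MvPowerSeries.coeff d (schur lam) := by
  refine coeff_monomialSum_mapDomain
    (((ssytEquiv lam).trans (bkEquiv lam.rowLen k)).trans (ssytEquiv lam).symm)
    (fun T => ssytWeight_eq fun c => ?_) d
  simp only [Equiv.trans_apply, Equiv.apply_symm_apply]
  rw [Finsupp.mapDomain_equiv_apply, Equiv.symm_swap]
  exact (ssytEquiv lam T).2.1.gtSize_bkReflect_succ k (gtSize_ssytEquiv_succ T) c

/-- Invariance under adjacent transpositions of the variables implies symmetry. -/
theorem isSymmetricSeries_of_swap {f : MvPowerSeries ℕ ℤ}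
    (h : ∀ (k : ℕ) (d : ℕ →₀ ℕ),
      MvPowerSeries.coeff (d.mapDomain (Equiv.swap k (k + 1))) f = MvPowerSeries.coeff d f) :
    IsSymmetricSeries f := by
  let Inv : Equiv.Perm ℕ → Prop := fun σ => ∀ d : ℕ →₀ ℕ,
    MvPowerSeries.coeff (d.mapDomain σ) f = MvPowerSeries.coeff d f
  have mul : ∀ σ τ, Inv σ → Inv τ → Inv (σ * τ) := by
    intro σ τ hσ hτ d
    rw [Equiv.Perm.coe_mul, Finsupp.mapDomain_comp, hσ, hτ]
  have one : Inv 1 := fun d => by rw [Equiv.Perm.coe_one, Finsupp.mapDomain_id]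
  have swap_add : ∀ i m, Inv (Equiv.swap i (i + m + 1)) := by
    intro i m
    induction m with
    | zero => exact h i
    | succ m ih =>
      have := mul _ _ (mul _ _ (h (i + m + 1)) ih) (h (i + m + 1))
      rwa [Equiv.swap_mul_swap_mul_swap (x := i) (y := i + m + 1) (z := i + m + 1 + 1) (by omega)
        (by omega), Equiv.swap_comm] at this
  have swap : ∀ i j, Inv (Equiv.swap i j) := by
    intro i j
    rcases lt_trichotomy i j with hij | rfl | hij
    · obtain ⟨m, rfl⟩ := Nat.exists_eq_add_of_lt hij
      exact swap_add i m
    · rw [Equiv.swap_self]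
      exact one
    · obtain ⟨m, rfl⟩ := Nat.exists_eq_add_of_lt hij
      rw [Equiv.swap_comm]
      exact swap_add j m
  -- Transpositions do not generate all of `Equiv.Perm ℕ`, but a monomial has finite support, so
  -- agreement with `σ` on a finite set suffices.
  have extend : ∀ (σ : Equiv.Perm ℕ) (S : Finset ℕ), ∃ τ, Inv τ ∧ ∀ x ∈ S, τ x = σ x := by
    intro σ S
    induction S using Finset.induction_on with
    | empty => exact ⟨1, one, by simp⟩
    | insert x S hx ih =>
      obtain ⟨τ, hτ, hS⟩ := ih
      refine ⟨Equiv.swap (τ x) (σ x) * τ, mul _ _ (swap _ _) hτ, fun y hy => ?_⟩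
      rcases Finset.mem_insert.mp hy with rfl | hy
      · simp
      · have hne : y ≠ x := fun e => hx (e ▸ hy)
        rw [Equiv.Perm.mul_apply, Equiv.swap_apply_of_ne_of_ne (fun e => hne (τ.injective e)),
          hS y hy]
        rw [hS y hy]
        exact fun e => hne (σ.injective e)
  intro σ d
  obtain ⟨τ, hτ, hd⟩ := extend σ d.support
  rw [← hτ d, Finsupp.mapDomain_congr hd]

theorem isSymmetricSeries_schur (lam : YoungDiagram) : IsSymmetricSeries (schur lam) :=
  isSymmetricSeries_of_swap (coeff_schur_mapDomain_swap lam)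

/-! ### Schur positivity of inverse descent classes -/

/-- Extension of a finite word by zeros. -/
def extendZero {n : ℕ} (t : Fin n → ℕ) (i : ℕ) : ℕ := if h : i < n then t ⟨i, h⟩ else 0

theorem extendZero_val {n : ℕ} (t : Fin n → ℕ) (i : Fin n) : extendZero t i = t i :=
  dif_pos i.2

/-- Lattice words of length `n` with ascent set `J`, that is, standard tableaux with descent set
`J`: the `i`-th letter is the row of the `i`-th box. -/
def LatticeWord (n : ℕ) (J : Finset (Fin (n - 1))) : Type :=
  {q : Fin n → ℕ // (∀ m ≤ n, Antitone (letterCount (extendZero q) m)) ∧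
    ∀ i, q (pos i) < q (posSucc i) ↔ i ∈ J}

theorem letterCount_pos_iff {q : ℕ → ℕ} {m a : ℕ} :
    0 < letterCount q m a ↔ ∃ i < m, q i = a := by
  simp [letterCount, Finset.card_pos, Finset.Nonempty]

/-- A letter `b + 1` must be preceded by a letter `b`. This bound makes lattice words finite in
number. -/
theorem le_of_antitone_letterCount {q : ℕ → ℕ} {m : ℕ}
    (h : ∀ i ≤ m, Antitone (letterCount q i)) {i : ℕ} (hi : i < m) : q i ≤ i := by
  induction i using Nat.strong_induction_on with
  | _ i ih =>
    rcases hq : q i with _ | b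
    · omega
    · have h1 : 0 < letterCount q (i + 1) (b + 1) := letterCount_pos_iff.mpr ⟨i, by omega, hq⟩
      obtain ⟨j, hj, hjb⟩ := letterCount_pos_iff.mp (h1.trans_le (h (i + 1) hi (Nat.le_succ b)))
      have hji : j ≠ i := by rintro rfl; omega
      have := ih j (by omega) (by omega)
      omega

theorem LatticeWord.letterCount_eq_zero {n : ℕ} {J : Finset (Fin (n - 1))} (q : LatticeWord n J)
    {a : ℕ} (ha : n ≤ a) : letterCount (extendZero q.1) n a = 0 := by
  by_contra h
  obtain ⟨i, hi, rfl⟩ := letterCount_pos_iff.mp (Nat.pos_of_ne_zero h)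
  have := le_of_antitone_letterCount q.2.1 hi
  omega

instance {n : ℕ} (J : Finset (Fin (n - 1))) : Finite (LatticeWord n J) := by
  have hfin : {q : Fin n → ℕ | ∀ i, q i ∈ Set.Iio n}.Finite :=
    Set.Finite.pi' fun _ : Fin n => Set.finite_Iio n
  have := hfin.to_subtype
  refine Finite.of_injective (fun q : LatticeWord n J =>
    (⟨q.1, fun i => ?_⟩ : {q : Fin n → ℕ | ∀ i, q i ∈ Set.Iio n})) fun q q' h => ?_
  · have := le_of_antitone_letterCount q.2.1 i.2
    rw [extendZero_val] at this
    exact this.trans_lt i.2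
  · exact Subtype.ext (congrArg Subtype.val h :)

noncomputable instance {n : ℕ} (J : Finset (Fin (n - 1))) : Fintype (LatticeWord n J) :=
  Fintype.ofFinite _

/-- The shape of a lattice word. -/
def LatticeWord.diagram {n : ℕ} {J : Finset (Fin (n - 1))} (q : LatticeWord n J) :
    YoungDiagram where
  cells := (Finset.range n).biUnion fun a =>
    (Finset.range (letterCount (extendZero q.1) n a)).image (Prod.mk a)
  isLowerSet := by
    rintro ⟨a, j⟩ ⟨a', j'⟩ h h'
    obtain ⟨h1, h2⟩ := Prod.mk_le_mk.mp h
    simp only [Finset.coe_biUnion, Set.mem_iUnion, Finset.coe_image, Set.mem_image, Finset.mem_coe,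
      Finset.mem_range, Prod.mk.injEq, exists_prop] at h' ⊢
    obtain ⟨b, hb, e, he, rfl, rfl⟩ := h'
    exact ⟨a', h1.trans_lt hb, j', h2.trans_lt (he.trans_le (q.2.1 n le_rfl h1)), rfl, rfl⟩

theorem LatticeWord.rowLen_diagram {n : ℕ} {J : Finset (Fin (n - 1))} (q : LatticeWord n J) :
    q.diagram.rowLen = letterCount (extendZero q.1) n := by
  funext a
  refine eq_of_forall_lt_iff fun j => ?_
  rw [← YoungDiagram.mem_iff_lt_rowLen, ← YoungDiagram.mem_cells]
  simp only [diagram, Finset.mem_biUnion, Finset.mem_image, Finset.mem_range, Prod.mk.injEq]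
  constructor
  · rintro ⟨b, hb, e, he, rfl, rfl⟩
    exact he
  · intro h
    refine ⟨a, ?_, j, h, rfl, rfl⟩
    by_contra ha
    rw [q.letterCount_eq_zero (not_lt.mp ha)] at h
    omega

/-- The recording word of a word. -/
noncomputable def recordingWord {n : ℕ} {J : Finset (Fin (n - 1))} (t : DescentWord n J) :
    LatticeWord n J :=
  ⟨fun i => rskQ (extendZero t.1) i, fun m hm => by
    rw [letterCount_congr (q' := rskQ (extendZero t.1)) fun i hi => dif_pos (hi.trans_le hm)]
    exact antitone_letterCount_rskQ _ m, fun i => by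
    rw [← t.2]
    refine (rskQ_lt_succ_iff (extendZero t.1) i).trans ?_
    exact iff_of_eq (congrArg₂ (· < ·) (extendZero_val t.1 (posSucc i))
      (extendZero_val t.1 (pos i)))⟩

theorem rowLen_diagram_recordingWord {n : ℕ} {J : Finset (Fin (n - 1))} (t : DescentWord n J) :
    (recordingWord t).diagram.rowLen = letterCount (rskQ (extendZero t.1)) n := by
  rw [LatticeWord.rowLen_diagram]
  exact letterCount_congr fun i hi => dif_pos hi

/-- The Robinson–Schensted–Knuth correspondence for words with descent set `J`. -/
noncomputable def rskEquiv {n : ℕ} (J : Finset (Fin (n - 1))) :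
    DescentWord n J ≃ Σ q : LatticeWord n J, GTPattern q.diagram.rowLen :=
  Equiv.ofBijective (fun t => ⟨recordingWord t, rskP (extendZero t.1) n, isGT_rskP _ n, by
      rw [rowLen_diagram_recordingWord]
      exact hasShape_rskP _ n⟩) <| by
    constructor
    · intro t t' h
      have hQ : recordingWord t = recordingWord t' := congrArg Sigma.fst h
      have hP : rskP (extendZero t.1) n = rskP (extendZero t'.1) n :=
        congrArg (fun x : Σ q : LatticeWord n J, GTPattern q.diagram.rowLen => x.2.1) h
      refine Subtype.ext (funext fun i => ?_)
      rw [← extendZero_val t.1 i, ← extendZero_val t'.1 i]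
      exact rsk_injective hP (fun j hj => congrFun (congrArg Subtype.val hQ) ⟨j, hj⟩) i i.2
    · rintro ⟨q, L, hL, hs⟩
      have hs' := hs
      rw [q.rowLen_diagram] at hs'
      obtain ⟨s, hP, hQ⟩ := rsk_surjective q.2.1 hL hs'
      have hs : ∀ i < n, extendZero (fun i : Fin n => s i) i = s i := fun i hi => dif_pos hi
      obtain ⟨t, ht⟩ : ∃ t : DescentWord n J, t.1 = fun i : Fin n => s i := ⟨⟨fun i => s i, fun i => by
        rw [← q.2.2, ← extendZero_val q.1 (pos i), ← extendZero_val q.1 (posSucc i),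
          ← hQ _ (pos i).2, ← hQ _ (posSucc i).2]
        exact (rskQ_lt_succ_iff s i).symm⟩, rfl⟩
      rw [← ht] at hs
      have hq : recordingWord t = q := by
        refine Subtype.ext (funext fun i => ?_)
        rw [← extendZero_val q.1 i, ← hQ i i.2]
        exact rskQ_congr fun j hj => hs j (hj.trans_lt i.2)
      have hp : rskP (extendZero t.1) n = L := (rskP_congr hs).trans hP
      refine ⟨t, ?_⟩
      subst hq
      exact Sigma.ext rfl (heq_of_eq (Subtype.ext hp))

theorem extendZero_letterCount {n : ℕ} (t : Fin n → ℕ) (c : ℕ) :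
    letterCount (extendZero t) n c = content t c := by
  rw [content_apply, letterCount, ← Finset.card_map Fin.valEmbedding]
  congr 1
  ext i
  simp only [Finset.mem_filter, Finset.mem_range, Finset.mem_map, Finset.mem_univ, true_and,
    Fin.valEmbedding_apply]
  constructor
  · rintro ⟨h1, h2⟩
    exact ⟨⟨i, h1⟩, by rw [← extendZero_val t]; exact h2, rfl⟩
  · rintro ⟨j, h1, rfl⟩
    exact ⟨j.2, by rw [extendZero_val, h1]⟩

/-- The words with descent set `J` are counted by Schur functions of standard tableaux with
descent set `J`. -/
theorem monomialSum_descentWord {n : ℕ} (J : Finset (Fin (n - 1))) :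
    (monomialSum fun t : DescentWord n J => content t.1) =
      ∑ q : LatticeWord n J, schur q.diagram := by
  let e : DescentWord n J ≃ Σ q : LatticeWord n J, SemistandardYoungTableau q.diagram :=
    (rskEquiv J).trans (Equiv.sigmaCongrRight fun q => (ssytEquiv q.diagram).symm)
  have he : ∀ t, ssytWeight (e t).2 = content t.1 := by
    intro t
    refine ssytWeight_eq fun c => ?_
    have h : (ssytEquiv (e t).1.diagram (e t).2).1 = rskP (extendZero t.1) n :=
      congrArg Subtype.val (Equiv.apply_symm_apply (ssytEquiv (rskEquiv J t).1.diagram) _)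
    rw [h, gtSize_rskP_succ, extendZero_letterCount]
  rw [monomialSum_congr e (b := fun x => ssytWeight x.2) he, monomialSum_sigma]
  · rfl
  · intro d
    have := finite_descentWord_content J d
    refine Finite.of_equiv {t : DescentWord n J // content t.1 = d} (e.subtypeEquiv fun t => ?_)
    rw [he]

theorem skewSchur_ribbon_eq_sum_schur {n : ℕ} (J : Finset (Fin (n - 1))) :
    skewSchur (ribbon n J) = ∑ q : LatticeWord n J, schur q.diagram :=
  (skewSchur_ribbon J).trans (monomialSum_descentWord J)

/-! ### Closure properties -/

theorem IsSymmetricSeries.sum {ι : Type*} {s : Finset ι} {f : ι → MvPowerSeries ℕ ℤ}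
    (h : ∀ i ∈ s, IsSymmetricSeries (f i)) : IsSymmetricSeries (∑ i ∈ s, f i) := by
  intro σ d
  rw [map_sum, map_sum]
  exact Finset.sum_congr rfl fun i hi => h i hi σ d

theorem isSchurPositive_schur (lam : YoungDiagram) : IsSchurPositive (schur lam) := by
  classical
  refine ⟨Finsupp.single lam 1, fun mu => ?_, ?_⟩
  · rw [Finsupp.single_apply]
    split_ifs <;> simp
  · rw [Finsupp.sum_single_index (zero_smul ℤ (schur lam)), one_smul]

theorem IsSchurPositive.sum {ι : Type*} {s : Finset ι} {f : ι → MvPowerSeries ℕ ℤ}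
    (h : ∀ i ∈ s, IsSchurPositive (f i)) : IsSchurPositive (∑ i ∈ s, f i) := by
  classical
  refine Finset.sum_induction f IsSchurPositive ?_ ⟨0, by simp, by simp⟩ h
  rintro f g ⟨c, hc, rfl⟩ ⟨d, hd, rfl⟩
  refine ⟨c + d, fun lam => add_nonneg (hc lam) (hd lam), ?_⟩
  exact (Finsupp.sum_add_index' (fun lam => zero_smul ℤ (schur lam))
    fun lam a b => add_smul a b (schur lam)).symm

/-! ### The quasisymmetric function of a one-column class -/

theorem Q_columnClass {n k : ℕ} (hn : 1 ≤ n) (v : Fin k → Sgn) :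
    Q (columnClass v n) =
      ∑ u : Fin (n - 1) → Sgn with ¬ IsSubword v u, skewSchur (ribbon n (wordSet u)) := by
  classical
  have h1 : ∀ u : Fin (n - 1) → Sgn, skewSchur (ribbon n (wordSet u)) =
      ∑ π : Equiv.Perm (Fin n) with desWord π⁻¹ = u, fundamental n (Des π) := by
    intro u
    rw [skewSchur_ribbon, ← sum_fundamental_invDescentClass]
    refine Finset.sum_congr (Finset.filter_congr fun π _ => ?_) fun _ _ => rfl
    rw [← wordSet_desWord, wordSet_injective.eq_iff]
  rw [Finset.sum_congr rfl fun u _ => h1 u, Q]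
  -- The class is fibred by the descent word of the inverse; membership depends only on this word,
  -- so each fibre is a full inverse descent class.
  rw [← Finset.sum_fiberwise_of_maps_to (g := fun π : Equiv.Perm (Fin n) => desWord π⁻¹)
    (t := Finset.univ.filter fun u : Fin (n - 1) → Sgn => ¬ IsSubword v u)]
  · refine Finset.sum_congr rfl fun u hu => ?_
    rw [Finset.filter_filter]
    refine Finset.sum_congr (Finset.filter_congr fun π _ => ?_) fun _ _ => rfl
    rw [mem_columnClass hn, and_iff_right_iff_imp]
    rintro rfl
    exact (Finset.mem_filter.mp hu).2
  · intro π hπ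
    exact Finset.mem_filter.mpr
      ⟨Finset.mem_univ _, (mem_columnClass hn).mp (Finset.mem_filter.mp hπ).2⟩

theorem isFine_columnClass {n k : ℕ} (hn : 1 ≤ n) (v : Fin k → Sgn) :
    IsFine (columnClass v n) := by
  simp only [IsFine, Q_columnClass hn, skewSchur_ribbon_eq_sum_schur]
  exact ⟨IsSymmetricSeries.sum fun u _ => IsSymmetricSeries.sum fun q _ =>
      isSymmetricSeries_schur q.diagram,
    IsSchurPositive.sum fun u _ => IsSchurPositive.sum fun q _ =>
      isSchurPositive_schur q.diagram⟩

end GridClasses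

theorem proposition4p5 (n : ℕ) (hn : 1 ≤ n) (k : ℕ) (v : Fin k → Sgn) :
    -- the inverse descent classes of different words are disjoint
    (∀ u u' : Fin (n - 1) → Sgn, u ≠ u' →
      Disjoint (invDescentClass (n := n) (wordSet u)) (invDescentClass (n := n) (wordSet u'))) ∧
    columnClass v n =
      Set.univ \ (⋃ (u : Fin (n - 1) → Sgn) (_ : IsSubword v u),
        invDescentClass (n := n) (wordSet u)) ∧
    columnClass v n =
      (⋃ (u : Fin (n - 1) → Sgn) (_ : ¬ IsSubword v u), invDescentClass (n := n) (wordSet u)) ∧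
    IsFine (columnClass v n) ∧
    Q (columnClass v n) =
      ∑ u : Fin (n - 1) → Sgn with ¬ IsSubword v u, skewSchur (ribbon n (wordSet u)) := by
  refine ⟨fun u u' hu => ?_, ?_, ?_, isFine_columnClass hn v, Q_columnClass hn v⟩
  · rw [Set.disjoint_left]
    intro π h h'
    rw [mem_invDescentClass_wordSet] at h h'
    exact hu (h.symm.trans h')
  · ext π
    simp [mem_columnClass hn, mem_invDescentClass_wordSet]
  · ext π
    simp [mem_columnClass hn, mem_invDescentClass_wordSet]
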